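/- Let $\nu>0$ be real, $M\ge 2$ an integer, and let $N_1,\dots,N_M$ be independent standard normal random variables. For each $n\ge 1$ let $c_{1,n},\dots,c_{M,n}$ be real numbers with $|c_{1,n}|\ge\dots\ge|c_{M,n}|$ and $\sum_{i=1}^M c_{i,n}^2=\nu$, and put $$F_n=\sum_{i=1}^M c_{i,n}(N_i^2-1).$$ Let $G(\nu)$ have the centered Gamma law, i.e. the law of $2\widehat G-\nu$ where $\widehat G$ has density $x^{\nu/2-1}e^{-x}/\Gamma(\nu/2)$ on $(0,\infty)$, and assume that $F_n\to G(\nu)$ in distribution. *Notation.* For a random variable $F$ with a finite chaos expansion $F=\sum_q I_q(f_q)$ over the Gaussian space generated by $N_1,\dots,N_M$, let $D$ be the Malliavin derivative, $L^{-1}F=-\sum_{q\ge1}\frac1q I_q(f_q)$, $\Gamma_0(F)=F$ and $\Gamma_{r+1}(F)=\langle D\Gamma_r(F),-DL^{-1}F\rangle$. Put $V_1(n)=\mathrm{Var}(\Gamma_1(F_n)-2F_n)$ and $V_3(n)=\mathrm{Var}(\Gamma_3(F_n)-2\Gamma_2(F_n))$. For real sequences, $a_n\asymp b_n$ means that $C_1|b_n|\le|a_n|\le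 C_2|b_n|$ for all large $n$, with constants $0<C_1<C_2$ that may depend on the sequences; $a_n\approx_C b_n$ means $a_n/b_n\to C$ for some constant $C>0$; $a_n=O(b_n)$ and $a_n=o(b_n)$ have their usual meaning. Then $\nu$ is an integer in $\{1,\dots,M\}$, and the limit law is that of $G_\nu:=\sum_{i=1}^{\nu}(N_i^2-1)$ (centered $\chi^2$ with $\nu$ degrees of freedom). Set $$\omega(n)=\max_{1\le i\le\nu}|1-c_{i,n}|,\qquad \vartheta(n)=\sum_{i=\nu+1}^M c_{i,n}^2 .$$ **$L^2$ convergence.** $F_n\to G_\nu$ in $L^2$, and there are constants $0<C_1<C_2$ with $$C_1\max\{\omega(n)^2,\vartheta(n)\}\le \mathbb E[(F_n-G_\nu)^2]\le C_2\max\{\omega(n)^2,\vartheta(n)\}\qquad\text{for all } n .$$ **(a)** $V_3\asymp V_1^2$ if and only if $\vartheta\asymp\omega$. If $\nu=1$, then $\vartheta\asymp\omega$. **(b)** $V_3\asymp V_1$ if and only if $\vartheta=O(\omega^2)$. If $\vartheta(n)/\omega(n)^2$ has a limit in $[0,\infty]$ (with the convention $0/0=0$), then $V_3\asymp V_1$ if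 and only if $\nu=M$, or $\vartheta\asymp\omega^2$, or $\vartheta=o(\omega^2)$. **Bounds for all $n$.** (i) If $\nu=1$ or $\vartheta\asymp\omega$, there are constants $0<C_1<C_2$ with $C_1V_1(n)^2\le V_3(n)\le C_2V_1(n)^2$ for all $n$. (ii) If $\nu=M$, or $\vartheta\asymp\omega^2$, or $\vartheta=o(\omega^2)$, there are constants $0<C_1<C_2$ with $C_1V_1(n)\le V_3(n)\le C_2V_1(n)$ for all $n$. **Versions with $\approx_C$.** Suppose that $\omega(n)\ne0$ for all large $n$. If $\nu=1$, then $\vartheta\approx_C\omega$. If moreover $\nu\le2$, or $\omega(n)^{-2}\sum_{i=1}^{\nu}(1-c_{i,n})^2$ converges as $n\to\infty$, then $V_3\approx_C V_1^2$ if and only if $\vartheta\approx_C\omega$; and $V_3\approx_C V_1$ if and only if $\nu=M$, or $\vartheta\approx_C\omega^2$, or $\vartheta=o(\omega^2)$. (The constants $C$ in different relations need not agree.) -/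

import Mathlib

open MeasureTheory ProbabilityTheory Filter Topology Asymptotics

namespace GammaApprox

noncomputable section

/-! ### Malliavin operators

The Gaussian space is the one generated by an i.i.d. standard normal family `N₁, …, N_M`, i.e. the
isonormal process `X(h) = ∑ hᵢ Nᵢ` over the Hilbert space `ℝ^M`.  The random variables with a finite
chaos expansion over this space are exactly the polynomials in `N₁, …, N_M`, so they are represented
by `p : MvPolynomial (Fin M) ℝ`, the random variable being `p(N₁, …, N_M)`. -/

/-- The random variable `p(N₁, …, N_M)`. -/
def realize {M : ℕ} {Ω : Type*} (N : Fin M → Ω → ℝ) (p : MvPolynomial (Fin M) ℝ) (ω : Ω) : ℝ :=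
  MvPolynomial.eval (fun i => N i ω) p

/-- The expectation `E[p(N₁, …, N_M)]` for i.i.d. standard normal `Nᵢ`. -/
def gaussExp {M : ℕ} (p : MvPolynomial (Fin M) ℝ) : ℝ :=
  ∫ x : Fin M → ℝ, MvPolynomial.eval x p ∂(Measure.pi fun _ => gaussianReal 0 1)

/-- The multivariate Hermite polynomial `∏ᵢ H_{αᵢ}(xᵢ)`, with the probabilists' `H_q`. -/
def hermiteMv {M : ℕ} (α : Fin M →₀ ℕ) : MvPolynomial (Fin M) ℝ :=
  ∏ i, Polynomial.aeval (MvPolynomial.X i : MvPolynomial (Fin M) ℝ) (Polynomial.hermite (α i))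

/-- The component `I_q(f_q)` of `p(N₁, …, N_M)` in the `q`-th Wiener chaos, i.e. its orthogonal
projection on the span of the orthogonal family `H_α`, `|α| = q`, where `E[H_α²] = ∏ αᵢ!`. -/
def chaosComponent {M : ℕ} (q : ℕ) (p : MvPolynomial (Fin M) ℝ) : MvPolynomial (Fin M) ℝ :=
  ∑ α ∈ Finset.finsuppAntidiag (Finset.univ : Finset (Fin M)) q,
    (gaussExp (p * hermiteMv α) / ∏ i, ((α i).factorial : ℝ)) • hermiteMv α

/-- The pseudo-inverse of the Ornstein–Uhlenbeck generator, `L⁻¹ F = -∑_{q ≥ 1} (1/q) I_q(f_q)`.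
The chaos components of order larger than the degree of `p` vanish. -/
def ouInv {M : ℕ} (p : MvPolynomial (Fin M) ℝ) : MvPolynomial (Fin M) ℝ :=
  -∑ q ∈ Finset.Icc 1 p.totalDegree, ((1 : ℝ) / q) • chaosComponent q p

/-- The Malliavin derivative `D p(N₁, …, N_M) = (∂ᵢ p(N₁, …, N_M))ᵢ`, an `ℝ^M`-valued variable. -/
def malliavinD {M : ℕ} (p : MvPolynomial (Fin M) ℝ) (i : Fin M) : MvPolynomial (Fin M) ℝ :=
  MvPolynomial.pderiv i p

/-- The iterated Gamma operators: `Γ₀(F) = F` and `Γ_{r+1}(F) = ⟨D Γ_r(F), -D L⁻¹ F⟩`. -/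
def gammaOp {M : ℕ} (p : MvPolynomial (Fin M) ℝ) : ℕ → MvPolynomial (Fin M) ℝ
  | 0 => p
  | r + 1 => ∑ i, malliavinD (gammaOp p r) i * -malliavinD (ouInv p) i

/-- `Var(Γ_{r+1}(F) - 2 Γ_r(F))` for `F = p(N₁, …, N_M)`. -/
def varGamma {M : ℕ} {Ω : Type*} [MeasurableSpace Ω] (N : Fin M → Ω → ℝ) (P : Measure Ω)
    (p : MvPolynomial (Fin M) ℝ) (r : ℕ) : ℝ :=
  variance (fun ω => realize N (gammaOp p (r + 1)) ω - 2 * realize N (gammaOp p r) ω) P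

/-! ### Weighted sums of centered chi-squares, the target law and the rates -/

/-- The polynomial `∑ᵢ cᵢ (xᵢ² - 1)`. -/
def chiPoly {M : ℕ} (c : Fin M → ℝ) : MvPolynomial (Fin M) ℝ :=
  ∑ i, MvPolynomial.C (c i) * (MvPolynomial.X i ^ 2 - 1)

/-- The random variable `∑ᵢ cᵢ (Nᵢ² - 1)`. -/
def chiSum {M : ℕ} {Ω : Type*} (N : Fin M → Ω → ℝ) (c : Fin M → ℝ) (ω : Ω) : ℝ :=
  ∑ i, c i * (N i ω ^ 2 - 1)

theorem realize_chiPoly {M : ℕ} {Ω : Type*} (N : Fin M → Ω → ℝ) (c : Fin M → ℝ) :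
    realize N (chiPoly c) = chiSum N c := by
  funext ω
  simp [realize, chiPoly, chiSum, map_sum]

/-- The sum of the first `k` centered squares, `∑_{i ≤ k} (Nᵢ² - 1)`. -/
def chiTarget {M : ℕ} {Ω : Type*} (N : Fin M → Ω → ℝ) (k : ℕ) (ω : Ω) : ℝ :=
  ∑ i with i.val < k, (N i ω ^ 2 - 1)

/-- The law `CenteredGamma(ν)` of `2 Ĝ - ν`, where `Ĝ` has the standard Gamma density
`x^(ν/2 - 1) e^(-x) / Γ(ν/2)` on `(0, ∞)`. -/
def centeredGamma (ν : ℝ) : Measure ℝ :=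
  (gammaMeasure (ν / 2) 1).map (fun x => 2 * x - ν)

/-- `ω = max {|1 - cᵢ| : i = 1, …, k}`. -/
def omegaRate {M : ℕ} (k : ℕ) (c : Fin M → ℝ) : ℝ :=
  ⨆ i : {i : Fin M // i.val < k}, |1 - c i|

/-- `ϑ = ∑_{i = k+1}^M cᵢ²`. -/
def thetaRate {M : ℕ} (k : ℕ) (c : Fin M → ℝ) : ℝ :=
  ∑ i with k ≤ i.val, c i ^ 2

/-- `∑_{i = 1}^k (1 - cᵢ)²`. -/
def headSq {M : ℕ} (k : ℕ) (c : Fin M → ℝ) : ℝ :=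
  ∑ i with i.val < k, (1 - c i) ^ 2

/-- `aₙ ≈_C bₙ`: the ratio `aₙ / bₙ` converges to a constant `C > 0`. -/
def ApproxC (a b : ℕ → ℝ) : Prop :=
  ∃ C : ℝ, 0 < C ∧ Tendsto (fun n => a n / b n) atTop (𝓝 C)

end

end GammaApprox

open GammaApprox

namespace GammaApprox

noncomputable section

/-! ### Moments of the standard normal and the Gamma laws -/

/-! Everything reduces to power sums of the coefficients. On a diagonal element of the second chaos
each Gamma step multiplies the coefficient of `xᵢ²` by `2cᵢ` (`gammaOp_chiPoly_succ`), so `V₁ = 8 ∑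
cᵢ²(1 - cᵢ)²` and `V₃ = 128 ∑ cᵢ⁶(1 - cᵢ)²`.

The third and fourth moments identify the limit: a limit point `d` of the coefficients has `∑ d² = ∑
d³ = ∑ d⁴ = ν`, hence `∑ d²(1 - d)² = 0`, so `d` consists of `ν` ones followed by zeros. Compactness
turns this into convergence of the coefficients (`exists_tendsto_headInd`).

With `H = ∑_{i ≤ k} (1 - cᵢ)²`, which is of order `ω²`, this gives `V₁ ~ 8(H + ϑ)` and `V₃ ~ 128 H`
(`isEquivalent_sum_sq_mul`, `isEquivalent_sum_pow_six_mul`). The fixed variance adds `2 ∑_{i ≤ k} (1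
- cᵢ) = H + ϑ` (`two_mul_sum_one_sub`), so `ϑ = O(ω)`. The order statements then compare `ω²` with
`(H + ϑ)²` or with `H + ϑ`.

For the `≈_C` versions `H / ω²` must be controlled as well: either its convergence is assumed, or `k
≤ 2`, where `headSq_eq_of_le_two` makes it a function of `(H + ϑ) / (2ω)`. -/

theorem integrable_pow_gaussianReal (n : ℕ) :
    Integrable (fun x : ℝ => x ^ n) (gaussianReal 0 1) := by
  refine integrable_pow_of_mem_interior_integrableExpSet (X := fun x : ℝ => x) ?_ n
  rw [integrableExpSet_fun_id_gaussianReal]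
  simp

/-- Gaussian integration by parts for monomials. -/
theorem integral_pow_add_two_gaussianReal (n : ℕ) :
    ∫ x, x ^ (n + 2) ∂(gaussianReal 0 1) = (n + 1) * ∫ x, x ^ n ∂(gaussianReal 0 1) := by
  have hint : ∀ m : ℕ, Integrable (fun x : ℝ => gaussianPDFReal 0 1 x * x ^ m) := by
    intro m
    have h := integrable_pow_gaussianReal m
    rw [gaussianReal_of_var_ne_zero 0 one_ne_zero, integrable_withDensity_iff_integrable_smul'
      (measurable_gaussianPDF 0 1) (by simp [gaussianPDF])] at h
    refine h.congr (Eventually.of_forall fun x => ?_)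
    simp [gaussianPDF, ENNReal.toReal_ofReal (gaussianPDFReal_nonneg 0 1 x)]
  rw [integral_gaussianReal_eq_integral_smul one_ne_zero,
    integral_gaussianReal_eq_integral_smul one_ne_zero]
  -- The Gaussian density satisfies `φ' = -xφ`; integrating `x ^ (n + 1)` against `φ'` by parts
  -- gives the recursion.
  have hderiv : ∀ x : ℝ, HasDerivAt (gaussianPDFReal 0 1) (-(x * gaussianPDFReal 0 1 x)) x := by
    intro x
    have h1 : HasDerivAt (fun y : ℝ => -y ^ 2 / 2) (-x) x := by
      have := ((hasDerivAt_pow 2 x).neg).div_const 2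
      refine this.congr_deriv ?_
      norm_num
      ring
    have h2 := (h1.exp).const_mul ((√(2 * Real.pi))⁻¹)
    have h3 : gaussianPDFReal 0 1 = fun y => (√(2 * Real.pi))⁻¹ * Real.exp (-y ^ 2 / 2) := by
      simp [gaussianPDFReal_def]
    rw [h3]
    exact h2.congr_deriv (by ring)
  have hparts := integral_mul_deriv_eq_deriv_mul_of_integrable
    (u := fun x : ℝ => x ^ (n + 1)) (u' := fun x => (n + 1) * x ^ n)
    (v := gaussianPDFReal 0 1) (v' := fun x => -(x * gaussianPDFReal 0 1 x))
    (fun x _ => by simpa using hasDerivAt_pow (n + 1) x) (fun x _ => hderiv x)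
    ((hint (n + 2)).neg.congr (Eventually.of_forall fun x => by simp; ring))
    (((hint n).const_mul (n + 1)).congr (Eventually.of_forall fun x => by simp; ring))
    ((hint (n + 1)).congr (Eventually.of_forall fun x => by simp; ring))
  rw [← integral_const_mul]
  have e1 : ∫ x : ℝ, x ^ (n + 1) * -(x * gaussianPDFReal 0 1 x) =
      -∫ x : ℝ, gaussianPDFReal 0 1 x • x ^ (n + 2) := by
    rw [← integral_neg]
    congr 1 with x
    simp only [smul_eq_mul]
    ring
  rw [e1, neg_inj] at hparts
  rw [hparts]
  congr 1 with x
  simp only [smul_eq_mul]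
  ring

theorem integral_pow_zero_gaussianReal : ∫ x, x ^ 0 ∂(gaussianReal 0 1) = 1 := by simp

theorem integral_pow_one_gaussianReal : ∫ x, x ^ 1 ∂(gaussianReal 0 1) = 0 := by
  simp [integral_id_gaussianReal]

theorem integral_pow_two_gaussianReal : ∫ x, x ^ 2 ∂(gaussianReal 0 1) = 1 := by
  rw [integral_pow_add_two_gaussianReal 0]; norm_num

theorem integral_pow_three_gaussianReal : ∫ x, x ^ 3 ∂(gaussianReal 0 1) = 0 := by
  rw [integral_pow_add_two_gaussianReal 1, integral_pow_one_gaussianReal]; norm_num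

theorem integral_pow_four_gaussianReal : ∫ x, x ^ 4 ∂(gaussianReal 0 1) = 3 := by
  rw [integral_pow_add_two_gaussianReal 2, integral_pow_two_gaussianReal]; norm_num

theorem integral_pow_six_gaussianReal : ∫ x, x ^ 6 ∂(gaussianReal 0 1) = 15 := by
  rw [integral_pow_add_two_gaussianReal 4, integral_pow_four_gaussianReal]; norm_num

theorem integral_pow_eight_gaussianReal : ∫ x, x ^ 8 ∂(gaussianReal 0 1) = 105 := by
  rw [integral_pow_add_two_gaussianReal 6, integral_pow_six_gaussianReal]; norm_num

/-- Only almost everywhere: the density is supported on the closed half-line, the Gamma integral on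
the open one. -/
theorem gammaPDFReal_mul_pow {a : ℝ} (n : ℕ) :
    (fun x : ℝ => gammaPDFReal a 1 x * x ^ n) =ᵐ[volume]
      (Set.Ioi (0 : ℝ)).indicator
        (fun x => (Real.Gamma a)⁻¹ * (Real.exp (-x) * x ^ (a + n - 1))) := by
  have h0 : ∀ᵐ x : ℝ ∂volume, x ≠ 0 := by simp [ae_iff]
  filter_upwards [h0] with x hx
  rcases lt_or_gt_of_ne hx with h | h
  · simp [gammaPDFReal, not_le.2 h, h.le]
  · rw [Set.indicator_of_mem (Set.mem_Ioi.2 h)]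
    have : x ^ (a + n - 1) = x ^ (a - 1) * x ^ n := by
      rw [← Real.rpow_natCast x n, ← Real.rpow_add h]; congr 1; ring
    rw [this]
    simp only [gammaPDFReal, if_pos h.le, Real.one_rpow, one_mul, one_div]
    ring

theorem integrable_pow_gammaMeasure {a : ℝ} (ha : 0 < a) (n : ℕ) :
    Integrable (fun x : ℝ => x ^ n) (gammaMeasure a 1) := by
  rw [gammaMeasure, integrable_withDensity_iff_integrable_smul'
    (f := gammaPDF a 1) (measurable_gammaPDFReal a 1).ennreal_ofReal (by simp [gammaPDF])]
  have h : Integrable (fun x : ℝ => gammaPDFReal a 1 x * x ^ n) := by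
    rw [integrable_congr (gammaPDFReal_mul_pow n), integrable_indicator_iff measurableSet_Ioi]
    exact (Real.GammaIntegral_convergent (by positivity)).const_mul _
  refine h.congr (Eventually.of_forall fun x => ?_)
  simp [gammaPDF, ENNReal.toReal_ofReal (gammaPDFReal_nonneg ha one_pos x)]

theorem integral_pow_gammaMeasure {a : ℝ} (ha : 0 < a) (n : ℕ) :
    ∫ x, x ^ n ∂(gammaMeasure a 1) = Real.Gamma (a + n) / Real.Gamma a := by
  rw [gammaMeasure, integral_withDensity_eq_integral_toReal_smul
    (f := gammaPDF a 1) (measurable_gammaPDFReal a 1).ennreal_ofReal (by simp [gammaPDF])]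
  have h : ∀ x : ℝ, (gammaPDF a 1 x).toReal • x ^ n = gammaPDFReal a 1 x * x ^ n := fun x => by
    simp [gammaPDF, ENNReal.toReal_ofReal (gammaPDFReal_nonneg ha one_pos x)]
  simp_rw [h]
  rw [integral_congr_ae (gammaPDFReal_mul_pow n), integral_indicator measurableSet_Ioi,
    integral_const_mul, ← Real.Gamma_eq_integral (by positivity)]
  ring

theorem integral_pow_succ_gammaMeasure {a : ℝ} (ha : 0 < a) (n : ℕ) :
    ∫ x, x ^ (n + 1) ∂(gammaMeasure a 1) = (a + n) * ∫ x, x ^ n ∂(gammaMeasure a 1) := by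
  rw [integral_pow_gammaMeasure ha, integral_pow_gammaMeasure ha, Nat.cast_add_one, ← add_assoc,
    Real.Gamma_add_one (by positivity)]
  ring

/-! ### Moments of sums of independent variables -/

section IndepSum

variable {Ω : Type*} [MeasurableSpace Ω] {P : Measure Ω} {X Y : Ω → ℝ}

theorem integrable_add_pow_of_indepFun (h : IndepFun X Y P)
    (hX : ∀ n : ℕ, Integrable (fun ω => X ω ^ n) P) (hY : ∀ n : ℕ, Integrable (fun ω => Y ω ^ n) P)
    (n : ℕ) : Integrable (fun ω => (X ω + Y ω) ^ n) P := by
  simp_rw [add_pow]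
  refine integrable_finsetSum _ fun m _ => Integrable.mul_const ?_ _
  exact (h.comp (measurable_id.pow_const m) (measurable_id.pow_const (n - m))).integrable_mul
    (hX m) (hY (n - m))

theorem integral_add_pow_of_indepFun (h : IndepFun X Y P)
    (hX : ∀ n : ℕ, Integrable (fun ω => X ω ^ n) P) (hY : ∀ n : ℕ, Integrable (fun ω => Y ω ^ n) P)
    (n : ℕ) : ∫ ω, (X ω + Y ω) ^ n ∂P =
      ∑ m ∈ Finset.range (n + 1), (∫ ω, X ω ^ m ∂P) * (∫ ω, Y ω ^ (n - m) ∂P) * n.choose m := by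
  simp_rw [add_pow]
  have hc : ∀ m, IndepFun (fun ω => X ω ^ m) (fun ω => Y ω ^ (n - m)) P := fun m =>
    h.comp (measurable_id.pow_const m) (measurable_id.pow_const (n - m))
  rw [integral_finsetSum]
  · refine Finset.sum_congr rfl fun m _ => ?_
    rw [integral_mul_const, (hc m).integral_fun_mul_eq_mul_integral (hX m).1 (hY (n - m)).1]
  · exact fun m _ => ((hc m).integrable_mul (hX m) (hY (n - m))).mul_const _

theorem integrable_sub_one_pow_of_hasLaw {N : Ω → ℝ} [IsProbabilityMeasure P]
    (hN : HasLaw N (gaussianReal 0 1) P) (n : ℕ) :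
    Integrable (fun ω => (N ω ^ 2 - 1) ^ n) P := by
  have hint : ∀ n : ℕ, Integrable (fun ω => (N ω ^ 2) ^ n) P := fun n => by
    simp_rw [← pow_mul]
    have := integrable_pow_gaussianReal (2 * n)
    rw [← hN.map_eq] at this
    exact this.comp_aemeasurable hN.aemeasurable
  simp_rw [sub_eq_add_neg]
  -- A constant is independent of everything, so centering is a case of the binomial formula for
  -- independent sums.
  exact integrable_add_pow_of_indepFun (indepFun_const_right _ (-1)) hint (fun n => integrable_const _) n

theorem integral_sub_one_pow_of_hasLaw {N : Ω → ℝ} [IsProbabilityMeasure P]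
    (hN : HasLaw N (gaussianReal 0 1) P) (n : ℕ) :
    ∫ ω, (N ω ^ 2 - 1) ^ n ∂P = ∑ m ∈ Finset.range (n + 1),
      (∫ x, x ^ (2 * m) ∂(gaussianReal 0 1)) * (-1) ^ (n - m) * n.choose m := by
  have hint : ∀ n : ℕ, Integrable (fun ω => (N ω ^ 2) ^ n) P := fun n => by
    simp_rw [← pow_mul]
    have := integrable_pow_gaussianReal (2 * n)
    rw [← hN.map_eq] at this
    exact this.comp_aemeasurable hN.aemeasurable
  simp_rw [sub_eq_add_neg]
  rw [integral_add_pow_of_indepFun (indepFun_const_right _ (-1)) hint (fun n => integrable_const _)]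
  refine Finset.sum_congr rfl fun m _ => ?_
  simp only [integral_const, probReal_univ, one_smul, ← pow_mul]
  congr 2
  exact hN.integral_comp (f := fun x : ℝ => x ^ (2 * m)) (by fun_prop)

end IndepSum

section ChiSum

variable {Ω : Type*} [MeasurableSpace Ω] {P : Measure Ω} [IsProbabilityMeasure P] {M : ℕ}
  {N : Fin M → Ω → ℝ}

theorem moments_sum_chi (hN : ∀ i, HasLaw (N i) (gaussianReal 0 1) P) (hind : iIndepFun N P)
    (d : Fin M → ℝ) (s : Finset (Fin M)) :
    (∀ n : ℕ, Integrable (fun ω => (∑ i ∈ s, d i * (N i ω ^ 2 - 1)) ^ n) P) ∧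
    ∫ ω, (∑ i ∈ s, d i * (N i ω ^ 2 - 1)) ^ 1 ∂P = 0 ∧
    ∫ ω, (∑ i ∈ s, d i * (N i ω ^ 2 - 1)) ^ 2 ∂P = 2 * ∑ i ∈ s, d i ^ 2 ∧
    ∫ ω, (∑ i ∈ s, d i * (N i ω ^ 2 - 1)) ^ 3 ∂P = 8 * ∑ i ∈ s, d i ^ 3 ∧
    ∫ ω, (∑ i ∈ s, d i * (N i ω ^ 2 - 1)) ^ 4 ∂P =
      48 * ∑ i ∈ s, d i ^ 4 + 12 * (∑ i ∈ s, d i ^ 2) ^ 2 := by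
  classical
  induction s using Finset.induction_on with
  | empty => simp
  | insert j s hj ih =>
    obtain ⟨hint, h1, h2, h3, h4⟩ := ih
    have hY : iIndepFun (fun i ω => d i * (N i ω ^ 2 - 1)) P :=
      hind.comp (fun i x => d i * (x ^ 2 - 1)) (fun i => by fun_prop)
    have hYm : ∀ i, AEMeasurable (fun ω => d i * (N i ω ^ 2 - 1)) P := fun i => by
      have := (hN i).aemeasurable
      fun_prop
    have hI : IndepFun (fun ω => d j * (N j ω ^ 2 - 1))
        (fun ω => ∑ i ∈ s, d i * (N i ω ^ 2 - 1)) P := by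
      have := (hY.indepFun_finsetSum_of_notMem₀ hYm hj).symm
      convert this using 1
      ext ω
      simp
    have hjint : ∀ n : ℕ, Integrable (fun ω => (d j * (N j ω ^ 2 - 1)) ^ n) P := fun n => by
      simp_rw [mul_pow]
      exact (integrable_sub_one_pow_of_hasLaw (hN j) n).const_mul _
    have hjn : ∀ n : ℕ, ∫ ω, (d j * (N j ω ^ 2 - 1)) ^ n ∂P = d j ^ n *
        ∑ m ∈ Finset.range (n + 1),
          (∫ x, x ^ (2 * m) ∂(gaussianReal 0 1)) * (-1) ^ (n - m) * n.choose m := fun n => by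
      simp_rw [mul_pow]
      rw [integral_const_mul, integral_sub_one_pow_of_hasLaw (hN j) n]
    have m0 := integral_pow_zero_gaussianReal
    have m2 := integral_pow_two_gaussianReal
    have m4 := integral_pow_four_gaussianReal
    have m6 := integral_pow_six_gaussianReal
    have m8 := integral_pow_eight_gaussianReal
    have j0 : ∫ ω, (d j * (N j ω ^ 2 - 1)) ^ 0 ∂P = 1 := by simp
    have j1 : ∫ ω, (d j * (N j ω ^ 2 - 1)) ^ 1 ∂P = 0 := by
      rw [hjn, Finset.sum_range_succ, Finset.sum_range_one, m0, m2]; norm_num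
    have j2 : ∫ ω, (d j * (N j ω ^ 2 - 1)) ^ 2 ∂P = 2 * d j ^ 2 := by
      rw [hjn]
      simp only [Finset.sum_range_succ, Finset.sum_range_zero]
      norm_num [m2, m4]
      ring
    have j3 : ∫ ω, (d j * (N j ω ^ 2 - 1)) ^ 3 ∂P = 8 * d j ^ 3 := by
      rw [hjn]
      simp only [Finset.sum_range_succ, Finset.sum_range_zero]
      norm_num [m2, m4, m6, Nat.choose]
      ring
    -- `60 = 105 - 4·15 + 6·3 - 4 + 1`, to be split as `48 + 12`: the `12` is the diagonal part of
    -- `12 (∑ d²)²`.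
    have j4 : ∫ ω, (d j * (N j ω ^ 2 - 1)) ^ 4 ∂P = 60 * d j ^ 4 := by
      rw [hjn]
      simp only [Finset.sum_range_succ, Finset.sum_range_zero]
      norm_num [m2, m4, m6, m8, Nat.choose]
      ring
    have s0 : ∫ ω, (∑ i ∈ s, d i * (N i ω ^ 2 - 1)) ^ 0 ∂P = 1 := by simp
    simp only [Finset.sum_insert hj]
    refine ⟨integrable_add_pow_of_indepFun hI hjint hint, ?_, ?_, ?_, ?_⟩ <;>
      rw [integral_add_pow_of_indepFun hI hjint hint] <;>
      simp only [Finset.sum_range_succ, Finset.sum_range_zero, Nat.sub_zero, Nat.sub_self,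
        Nat.reduceSub, j0, j1, j2, j3, j4, s0, h1, h2, h3, h4] <;>
      norm_num [Nat.choose] <;> ring

end ChiSum

/-- Moments of the centered Gamma law. -/
theorem moments_centeredGamma {ν : ℝ} (hν : 0 < ν) :
    ∫ x, x ^ 3 ∂(centeredGamma ν) = 8 * ν ∧
    ∫ x, x ^ 4 ∂(centeredGamma ν) = 48 * ν + 12 * ν ^ 2 := by
  have ha : 0 < ν / 2 := by positivity
  have := isProbabilityMeasure_gammaMeasure ha one_pos
  have hint : ∀ n : ℕ, Integrable (fun x : ℝ => (2 * x) ^ n) (gammaMeasure (ν / 2) 1) :=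
    fun n => by
      simp_rw [mul_pow]
      exact (integrable_pow_gammaMeasure ha n).const_mul _
  have key : ∀ n : ℕ, ∫ x, x ^ n ∂(centeredGamma ν) = ∑ m ∈ Finset.range (n + 1),
      (2 ^ m * ∫ x, x ^ m ∂(gammaMeasure (ν / 2) 1)) * (-ν) ^ (n - m) * n.choose m := by
    intro n
    rw [centeredGamma, integral_map (by fun_prop) (by fun_prop)]
    simp_rw [sub_eq_add_neg]
    rw [integral_add_pow_of_indepFun (indepFun_const_right _ (-ν)) hint (fun n => integrable_const _)]
    refine Finset.sum_congr rfl fun m _ => ?_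
    simp [mul_pow, integral_const_mul]
  have g0 : ∫ x, x ^ 0 ∂(gammaMeasure (ν / 2) 1) = 1 := by simp
  have g1 := integral_pow_succ_gammaMeasure ha 0
  rw [g0] at g1
  have g2 := integral_pow_succ_gammaMeasure ha 1
  rw [g1] at g2
  have g3 := integral_pow_succ_gammaMeasure ha 2
  rw [g2] at g3
  have g4 := integral_pow_succ_gammaMeasure ha 3
  rw [g3] at g4
  simp only [Nat.reduceAdd] at g1 g2 g3 g4
  constructor <;> rw [key] <;>
    simp only [Finset.sum_range_succ, Finset.sum_range_zero, g0, g1, g2, g3, g4] <;>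
    norm_num [Nat.choose] <;> ring

end

end GammaApprox

namespace GammaApprox

noncomputable section

/-! ### The Gamma operators on the second chaos -/

section Hermite

open Polynomial in
theorem hermite_two_eq : Polynomial.hermite 2 = (X ^ 2 - 1 : ℤ[X]) := by
  rw [Polynomial.hermite_succ, Polynomial.hermite_one]
  simp [sq]

theorem integrable_aeval_gaussianReal (p : Polynomial ℤ) :
    Integrable (fun x : ℝ => Polynomial.aeval x p) (gaussianReal 0 1) := by
  simp_rw [Polynomial.aeval_eq_sum_range]
  refine integrable_finsetSum _ fun n _ => ?_
  simp_rw [zsmul_eq_mul]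
  exact (integrable_pow_gaussianReal n).const_mul _

variable {M : ℕ}

theorem eval_hermiteMv (α : Fin M →₀ ℕ) (x : Fin M → ℝ) :
    MvPolynomial.eval x (hermiteMv α) =
      ∏ i, Polynomial.aeval (x i) (Polynomial.hermite (α i)) := by
  rw [hermiteMv, map_prod]
  refine Finset.prod_congr rfl fun i _ => ?_
  rw [Polynomial.aeval_def, Polynomial.hom_eval₂, MvPolynomial.eval_X, Polynomial.aeval_def]
  congr 1
  exact RingHom.ext_int _ _

theorem hermiteMv_single_two (i : Fin M) :
    hermiteMv (Finsupp.single i 2) = (MvPolynomial.X i ^ 2 - 1 : MvPolynomial (Fin M) ℝ) := by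
  rw [hermiteMv, Finset.prod_eq_single i]
  · simp [hermite_two_eq, -Polynomial.hermite_succ]
  · intro j _ hj
    simp [Finsupp.single_eq_of_ne hj]
  · simp

theorem integrable_eval_hermiteMv_mul (α β : Fin M →₀ ℕ) :
    Integrable (fun x => MvPolynomial.eval x (hermiteMv α * hermiteMv β))
      (Measure.pi fun _ : Fin M => gaussianReal 0 1) := by
  simp_rw [map_mul, eval_hermiteMv, ← Finset.prod_mul_distrib, ← map_mul]
  exact Integrable.fintype_prod
    (f := fun i (x : ℝ) => Polynomial.aeval x (Polynomial.hermite (α i) * Polynomial.hermite (β i)))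
    fun i => integrable_aeval_gaussianReal _

theorem gaussExp_hermiteMv_mul (α β : Fin M →₀ ℕ) :
    gaussExp (hermiteMv α * hermiteMv β) =
      ∏ i, ∫ x : ℝ, Polynomial.aeval x (Polynomial.hermite (α i)) *
        Polynomial.aeval x (Polynomial.hermite (β i)) ∂(gaussianReal 0 1) := by
  rw [gaussExp]
  simp_rw [map_mul, eval_hermiteMv, ← Finset.prod_mul_distrib]
  exact integral_fintype_prod_eq_prod
    (f := fun i (x : ℝ) => Polynomial.aeval x (Polynomial.hermite (α i)) *
        Polynomial.aeval x (Polynomial.hermite (β i)))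

theorem integral_hermite_two :
    ∫ x : ℝ, Polynomial.aeval x (Polynomial.hermite 2) ∂(gaussianReal 0 1) = 0 := by
  have h : ∀ x : ℝ, Polynomial.aeval x (Polynomial.hermite 2) = x ^ 2 - x ^ 0 := fun x => by
    simp [hermite_two_eq, -Polynomial.hermite_succ]
  simp_rw [h]
  rw [integral_sub (integrable_pow_gaussianReal 2) (integrable_pow_gaussianReal 0),
    integral_pow_two_gaussianReal, integral_pow_zero_gaussianReal, sub_self]

theorem integral_hermite_two_mul_one :
    ∫ x : ℝ, Polynomial.aeval x (Polynomial.hermite 2) * Polynomial.aeval x (Polynomial.hermite 1)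
      ∂(gaussianReal 0 1) = 0 := by
  have h : ∀ x : ℝ, Polynomial.aeval x (Polynomial.hermite 2) *
      Polynomial.aeval x (Polynomial.hermite 1) = x ^ 3 - x ^ 1 := fun x => by
    simp only [hermite_two_eq, Polynomial.hermite_one, map_sub, map_pow, map_one,
      Polynomial.aeval_X]
    ring
  simp_rw [h]
  rw [integral_sub (integrable_pow_gaussianReal 3) (integrable_pow_gaussianReal 1),
    integral_pow_three_gaussianReal, integral_pow_one_gaussianReal, sub_self]

theorem integral_hermite_two_mul_two :
    ∫ x : ℝ, Polynomial.aeval x (Polynomial.hermite 2) * Polynomial.aeval x (Polynomial.hermite 2)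
      ∂(gaussianReal 0 1) = 2 := by
  have h : ∀ x : ℝ, Polynomial.aeval x (Polynomial.hermite 2) *
      Polynomial.aeval x (Polynomial.hermite 2) = x ^ 4 - 2 * x ^ 2 + x ^ 0 := fun x => by
    simp only [hermite_two_eq, map_sub, map_pow, map_one,
      Polynomial.aeval_X]
    ring
  simp_rw [h]
  have h42 : Integrable (fun x : ℝ => x ^ 4 - 2 * x ^ 2) (gaussianReal 0 1) :=
    (integrable_pow_gaussianReal 4).sub ((integrable_pow_gaussianReal 2).const_mul 2)
  rw [integral_add h42 (integrable_pow_gaussianReal 0),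
    integral_sub (integrable_pow_gaussianReal 4) ((integrable_pow_gaussianReal 2).const_mul 2),
    integral_const_mul, integral_pow_four_gaussianReal, integral_pow_two_gaussianReal,
    integral_pow_zero_gaussianReal]
  norm_num

/-- If `|α| ≤ 2` and `α ≠ 2eᵢ` then `αᵢ ≤ 1`, and the `i`-th factor of the product integral vanishes
by orthogonality of `H₂` to `H₀` and `H₁`. -/
theorem gaussExp_hermiteMv_single_two_mul (i : Fin M) (α : Fin M →₀ ℕ) (hα : ∑ j, α j ≤ 2) :
    gaussExp (hermiteMv (Finsupp.single i 2) * hermiteMv α) =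
      if α = Finsupp.single i 2 then 2 else 0 := by
  rw [gaussExp_hermiteMv_mul]
  split_ifs with h
  · subst h
    rw [Finset.prod_eq_single i]
    · rw [Finsupp.single_eq_same, integral_hermite_two_mul_two]
    · intro j _ hj
      simp [Finsupp.single_eq_of_ne hj]
    · simp
  · have hsum : α i + ∑ j ∈ Finset.univ.erase i, α j = ∑ j, α j :=
      Finset.add_sum_erase _ _ (Finset.mem_univ i)
    have hi : α i = 0 ∨ α i = 1 := by
      by_contra hcon
      refine h ?_
      ext j
      by_cases hj : j = i
      · subst hj
        rw [Finsupp.single_eq_same]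
        omega
      · rw [Finsupp.single_eq_of_ne hj]
        have := Finset.single_le_sum (f := fun j => α j) (fun _ _ => Nat.zero_le _)
          (Finset.mem_erase.2 ⟨hj, Finset.mem_univ j⟩)
        omega
    refine Finset.prod_eq_zero (Finset.mem_univ i) ?_
    rcases hi with hi | hi <;> rw [hi, Finsupp.single_eq_same]
    · simpa [-Polynomial.hermite_succ] using integral_hermite_two
    · exact integral_hermite_two_mul_one

theorem chiPoly_eq_sum_hermiteMv (c : Fin M → ℝ) :
    chiPoly c = ∑ i, c i • hermiteMv (Finsupp.single i 2) := by
  simp [chiPoly, hermiteMv_single_two, MvPolynomial.smul_eq_C_mul]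

theorem gaussExp_chiPoly_mul (c : Fin M → ℝ) (α : Fin M →₀ ℕ) (hα : ∑ j, α j ≤ 2) :
    gaussExp (chiPoly c * hermiteMv α) =
      ∑ i, c i * if α = Finsupp.single i 2 then 2 else 0 := by
  rw [chiPoly_eq_sum_hermiteMv, Finset.sum_mul, gaussExp]
  simp_rw [smul_mul_assoc, map_sum, MvPolynomial.smul_eval]
  rw [integral_finsetSum _ fun i _ => (integrable_eval_hermiteMv_mul _ α).const_mul _]
  refine Finset.sum_congr rfl fun i _ => ?_
  rw [integral_const_mul, ← gaussExp_hermiteMv_single_two_mul i α hα, gaussExp]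

theorem chaosComponent_one_chiPoly (c : Fin M → ℝ) : chaosComponent 1 (chiPoly c) = 0 := by
  refine Finset.sum_eq_zero fun α hα => ?_
  rw [Finset.mem_finsuppAntidiag] at hα
  rw [gaussExp_chiPoly_mul c α (by rw [hα.1]; norm_num), Finset.sum_eq_zero, zero_div, zero_smul]
  intro i _
  rw [if_neg, mul_zero]
  rintro rfl
  simpa [Finsupp.single_apply] using hα.1

theorem chaosComponent_two_chiPoly (c : Fin M → ℝ) : chaosComponent 2 (chiPoly c) = chiPoly c := by
  classical
  rw [chaosComponent]
  have h : ∀ α ∈ Finset.finsuppAntidiag (Finset.univ : Finset (Fin M)) 2,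
      (gaussExp (chiPoly c * hermiteMv α) / ∏ i, ((α i).factorial : ℝ)) • hermiteMv α =
        ∑ i, if α = Finsupp.single i 2 then c i • hermiteMv (Finsupp.single i 2)
          else (0 : MvPolynomial (Fin M) ℝ) := by
    intro α hα
    rw [Finset.mem_finsuppAntidiag] at hα
    rw [gaussExp_chiPoly_mul c α hα.1.le, Finset.sum_div, Finset.sum_smul]
    refine Finset.sum_congr rfl fun i _ => ?_
    split_ifs with hi
    · subst hi
      have : ∏ j, (((Finsupp.single i 2 : Fin M →₀ ℕ) j).factorial : ℝ) = 2 := by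
        rw [Finset.prod_eq_single i]
        · simp
        · intro j _ hj
          simp [Finsupp.single_eq_of_ne hj]
        · simp
      rw [this]
      congr 1
      ring
    · simp
  rw [Finset.sum_congr rfl h, Finset.sum_comm, chiPoly_eq_sum_hermiteMv]
  refine Finset.sum_congr rfl fun i _ => ?_
  rw [Finset.sum_ite_eq', if_pos]
  rw [Finset.mem_finsuppAntidiag]
  refine ⟨?_, by simp⟩
  simp [Finsupp.single_apply]

theorem totalDegree_chiPoly {c : Fin M → ℝ} (hc : c ≠ 0) : (chiPoly c).totalDegree = 2 := by
  apply le_antisymm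
  · refine MvPolynomial.totalDegree_finsetSum_le fun i _ => ?_
    refine (MvPolynomial.totalDegree_mul _ _).trans ?_
    rw [MvPolynomial.totalDegree_C, zero_add]
    refine (MvPolynomial.totalDegree_sub _ _).trans ?_
    simp
  · obtain ⟨i, hi⟩ := Function.ne_iff.1 hc
    have h0 : ∀ j : Fin M, (0 : Fin M →₀ ℕ) ≠ Finsupp.single j 2 := fun j h => by
      simpa using DFunLike.congr_fun h j
    have hcoeff : MvPolynomial.coeff (Finsupp.single i 2) (chiPoly c) = c i := by
      rw [chiPoly, MvPolynomial.coeff_sum, Finset.sum_eq_single i]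
      · simp [MvPolynomial.coeff_one, MvPolynomial.coeff_X_pow, h0]
      · intro j _ hj
        simp [MvPolynomial.coeff_one, MvPolynomial.coeff_X_pow, Finsupp.single_left_inj, hj, h0]
      · simp
    have := MvPolynomial.le_totalDegree (p := chiPoly c) (s := Finsupp.single i 2)
      (by rw [MvPolynomial.mem_support_iff, hcoeff]; exact hi)
    simpa using this

/-- The polynomial lies entirely in the second chaos; `c ≠ 0` makes its degree exactly 2, so the sum
runs over `q = 1, 2`. -/
theorem ouInv_chiPoly {c : Fin M → ℝ} (hc : c ≠ 0) :
    ouInv (chiPoly c) = -((1 / 2 : ℝ) • chiPoly c) := by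
  rw [ouInv, totalDegree_chiPoly hc, Finset.sum_Icc_succ_top (by norm_num)]
  simp [chaosComponent_one_chiPoly, chaosComponent_two_chiPoly]

theorem pderiv_sum_C_mul_X_sq (a : Fin M → ℝ) (i : Fin M) :
    MvPolynomial.pderiv i (∑ j, MvPolynomial.C (a j) * MvPolynomial.X j ^ 2) =
      MvPolynomial.C (2 * a i) * MvPolynomial.X i := by
  rw [map_sum, Finset.sum_eq_single i]
  · rw [MvPolynomial.pderiv_mul, MvPolynomial.pderiv_C, MvPolynomial.pderiv_pow,
      MvPolynomial.pderiv_X_self, map_mul, map_ofNat]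
    push_cast
    ring
  · intro j _ hj
    rw [MvPolynomial.pderiv_mul, MvPolynomial.pderiv_C, MvPolynomial.pderiv_pow,
      MvPolynomial.pderiv_X_of_ne hj]
    ring
  · simp

theorem pderiv_chiPoly (c : Fin M → ℝ) (i : Fin M) :
    MvPolynomial.pderiv i (chiPoly c) = MvPolynomial.C (2 * c i) * MvPolynomial.X i := by
  rw [← pderiv_sum_C_mul_X_sq, chiPoly]
  simp_rw [mul_sub, mul_one, Finset.sum_sub_distrib, map_sub]
  simp

theorem neg_malliavinD_ouInv_chiPoly {c : Fin M → ℝ} (hc : c ≠ 0) (i : Fin M) :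
    -malliavinD (ouInv (chiPoly c)) i = MvPolynomial.C (c i) * MvPolynomial.X i := by
  rw [malliavinD, ouInv_chiPoly hc, map_neg, neg_neg, Derivation.map_smul, pderiv_chiPoly,
    MvPolynomial.smul_eq_C_mul, ← mul_assoc, ← map_mul]
  congr 2
  ring

/-- Differentiating `a xᵢ²` and multiplying by `cᵢ xᵢ` gives `2 a cᵢ xᵢ²`. The formula starts at
index 1, because `Γ₀` also carries the constant `-∑ cᵢ`. -/
theorem gammaOp_chiPoly_succ {c : Fin M → ℝ} (hc : c ≠ 0) (r : ℕ) :
    gammaOp (chiPoly c) (r + 1) =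
      ∑ i, MvPolynomial.C (2 ^ (r + 1) * c i ^ (r + 2)) * MvPolynomial.X i ^ 2 := by
  induction r with
  | zero =>
    rw [gammaOp]
    refine Finset.sum_congr rfl fun i _ => ?_
    rw [neg_malliavinD_ouInv_chiPoly hc, gammaOp, malliavinD, pderiv_chiPoly]
    simp only [map_mul, map_pow]
    ring
  | succ r ih =>
    rw [gammaOp]
    refine Finset.sum_congr rfl fun i _ => ?_
    rw [neg_malliavinD_ouInv_chiPoly hc, ih, malliavinD, pderiv_sum_C_mul_X_sq]
    simp only [map_mul, map_pow]
    ring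

end Hermite

/-! ### Variances as power sums of the coefficients -/

section Variance

theorem aemeasurable_chiSum {Ω : Type*} [MeasurableSpace Ω] {P : Measure Ω} {M : ℕ}
    {N : Fin M → Ω → ℝ} (hN : ∀ i, HasLaw (N i) (gaussianReal 0 1) P) (a : Fin M → ℝ) :
    AEMeasurable (chiSum N a) P := by
  have := fun i => (hN i).aemeasurable
  unfold chiSum
  fun_prop

variable {Ω : Type*} [MeasurableSpace Ω] {P : Measure Ω} [IsProbabilityMeasure P] {M : ℕ}
  {N : Fin M → Ω → ℝ}

theorem memLp_chiSum (hN : ∀ i, HasLaw (N i) (gaussianReal 0 1) P) (hind : iIndepFun N P)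
    (a : Fin M → ℝ) : MemLp (chiSum N a) 2 P :=
  (memLp_two_iff_integrable_sq (aemeasurable_chiSum hN a).aestronglyMeasurable).2
    ((moments_sum_chi hN hind a Finset.univ).1 2)

theorem integral_chiSum_sq (hN : ∀ i, HasLaw (N i) (gaussianReal 0 1) P) (hind : iIndepFun N P)
    (a : Fin M → ℝ) : ∫ ω, chiSum N a ω ^ 2 ∂P = 2 * ∑ i, a i ^ 2 :=
  (moments_sum_chi hN hind a Finset.univ).2.2.1

theorem variance_chiSum_add_const (hN : ∀ i, HasLaw (N i) (gaussianReal 0 1) P)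
    (hind : iIndepFun N P) (a : Fin M → ℝ) (b : ℝ) :
    variance (fun ω => chiSum N a ω + b) P = 2 * ∑ i, a i ^ 2 := by
  rw [variance_add_const (aemeasurable_chiSum hN a).aestronglyMeasurable,
    variance_of_integral_eq_zero (aemeasurable_chiSum hN a), integral_chiSum_sq hN hind]
  simpa [chiSum] using (moments_sum_chi hN hind a Finset.univ).2.1

theorem varGamma_chiPoly_zero (hN : ∀ i, HasLaw (N i) (gaussianReal 0 1) P)
    (hind : iIndepFun N P) {c : Fin M → ℝ} (hc : c ≠ 0) :
    varGamma N P (chiPoly c) 0 = 8 * ∑ i, c i ^ 2 * (1 - c i) ^ 2 := by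
  -- Up to a constant, invisible to the variance, the difference is again a weighted sum of centered
  -- squares.
  have h : (fun ω => realize N (gammaOp (chiPoly c) (0 + 1)) ω -
      2 * realize N (gammaOp (chiPoly c) 0) ω) =
      fun ω => chiSum N (fun i => 2 * c i ^ 2 - 2 * c i) ω + ∑ i, 2 * c i ^ 2 := by
    ext ω
    rw [gammaOp_chiPoly_succ hc 0, gammaOp, realize_chiPoly]
    simp only [realize, chiSum, map_sum, map_mul, map_pow, MvPolynomial.eval_C,
      MvPolynomial.eval_X, Finset.mul_sum, ← Finset.sum_sub_distrib, ← Finset.sum_add_distrib]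
    refine Finset.sum_congr rfl fun i _ => ?_
    ring
  rw [varGamma, h, variance_chiSum_add_const hN hind, Finset.mul_sum, Finset.mul_sum]
  refine Finset.sum_congr rfl fun i _ => ?_
  ring

theorem varGamma_chiPoly_two (hN : ∀ i, HasLaw (N i) (gaussianReal 0 1) P)
    (hind : iIndepFun N P) {c : Fin M → ℝ} (hc : c ≠ 0) :
    varGamma N P (chiPoly c) 2 = 128 * ∑ i, c i ^ 6 * (1 - c i) ^ 2 := by
  have h : (fun ω => realize N (gammaOp (chiPoly c) (2 + 1)) ω -
      2 * realize N (gammaOp (chiPoly c) 2) ω) =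
      fun ω => chiSum N (fun i => 8 * c i ^ 4 - 8 * c i ^ 3) ω + ∑ i, (8 * c i ^ 4 - 8 * c i ^ 3) := by
    ext ω
    rw [gammaOp_chiPoly_succ hc 2, gammaOp_chiPoly_succ hc 1]
    simp only [realize, chiSum, map_sum, map_mul, map_pow, MvPolynomial.eval_C,
      MvPolynomial.eval_X, Finset.mul_sum, ← Finset.sum_sub_distrib, ← Finset.sum_add_distrib]
    refine Finset.sum_congr rfl fun i _ => ?_
    ring
  rw [varGamma, h, variance_chiSum_add_const hN hind, Finset.mul_sum, Finset.mul_sum]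
  refine Finset.sum_congr rfl fun i _ => ?_
  ring

end Variance

end

end GammaApprox

namespace GammaApprox

noncomputable section

/-! ### Identification of the limit -/

/-- The coefficients `(1, …, 1, 0, …, 0)` of the target, with `k` ones. -/
def headInd {M : ℕ} (k : ℕ) (i : Fin M) : ℝ := if i.val < k then 1 else 0

theorem chiSum_headInd {M : ℕ} {Ω : Type*} (N : Fin M → Ω → ℝ) (k : ℕ) :
    chiSum N (headInd k) = chiTarget N k := by
  ext ω
  simp only [chiSum, chiTarget, headInd, Finset.sum_filter, ite_mul, one_mul, zero_mul]

theorem sum_headInd_sq {M k : ℕ} (hk : k ≤ M) : ∑ i : Fin M, headInd k i ^ 2 = k := by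
  have h : ∀ i : Fin M, headInd k i ^ 2 = if i.val < k then (1 : ℝ) else 0 := fun i => by
    unfold headInd
    split_ifs <;> norm_num
  simp_rw [h, Finset.sum_boole]
  have : (Finset.univ.filter fun i : Fin M => i.val < k).card = k := by
    rw [Fin.card_filter_val_lt, min_eq_right hk]
  exact_mod_cast this

/-- A vector with `∑ d² = ∑ d³ = ∑ d⁴` has all its entries in `{0, 1}`. -/
theorem eq_zero_or_one_of_sum_pow_eq {ι : Type*} [Fintype ι] {d : ι → ℝ}
    (h3 : ∑ i, d i ^ 3 = ∑ i, d i ^ 2) (h4 : ∑ i, d i ^ 4 = ∑ i, d i ^ 2) (i : ι) :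
    d i = 0 ∨ d i = 1 := by
  have h : ∑ i, (d i * (1 - d i)) ^ 2 = 0 := by
    have : ∀ i, (d i * (1 - d i)) ^ 2 = d i ^ 2 - 2 * d i ^ 3 + d i ^ 4 := fun i => by ring
    simp_rw [this, Finset.sum_add_distrib, Finset.sum_sub_distrib, ← Finset.mul_sum, h3, h4]
    ring
  have := (Finset.sum_eq_zero_iff_of_nonneg fun i _ => sq_nonneg _).1 h i (Finset.mem_univ i)
  rcases mul_eq_zero.1 (pow_eq_zero_iff two_ne_zero |>.1 this) with h | h
  · exact Or.inl h
  · exact Or.inr (by linarith)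

theorem exists_eq_headInd {M : ℕ} {d : Fin M → ℝ} (hd : ∀ i, d i = 0 ∨ d i = 1)
    (hanti : Antitone fun i => |d i|) : ∃ k ≤ M, d = headInd k := by
  classical
  -- `k` is the length of the longest initial block of ones; since `|d|` is antitone, no one can
  -- follow a zero.
  set p : ℕ → Prop := fun m => ∀ i : Fin M, i.val < m → d i = 1 with hp
  refine ⟨Nat.findGreatest p M, Nat.findGreatest_le M, ?_⟩
  ext i
  unfold headInd
  split_ifs with hi
  · exact Nat.findGreatest_spec (P := p) (Nat.zero_le M) (fun i hi => absurd hi (by omega)) i hi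
  · rcases hd i with h | h
    · exact h
    · refine absurd ?_ hi
      refine Nat.lt_of_succ_le (Nat.le_findGreatest i.isLt fun j hj => ?_)
      rcases hd j with h' | h'
      · have := hanti (Fin.le_def.2 (Nat.lt_succ_iff.1 hj))
        simp only [h, h'] at this
        norm_num at this
      · exact h'

section Limit

variable {Ω : Type*} [MeasurableSpace Ω] {P : Measure Ω} [IsProbabilityMeasure P]
  {Ω' : Type*} [MeasurableSpace Ω'] {P' : Measure Ω'} [IsProbabilityMeasure P']
  {M : ℕ} {N : Fin M → Ω → ℝ} {ν : ℝ} {G : Ω' → ℝ}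

/-- A limit point of the coefficients is of the form `(1, …, 1, 0, …, 0)`. -/
theorem exists_eq_headInd_of_tendsto (hν : 0 < ν)
    (hN : ∀ i, HasLaw (N i) (gaussianReal 0 1) P) (hind : iIndepFun N P) {c : ℕ → Fin M → ℝ}
    (hord : ∀ n, Antitone fun i => |c n i|) (hvar : ∀ n, ∑ i, c n i ^ 2 = ν)
    (hG : HasLaw G (centeredGamma ν) P')
    (hconv : TendstoInDistribution (fun n => chiSum N (c n)) atTop G (fun _ => P) P')
    {d : Fin M → ℝ} (hd : Tendsto c atTop (𝓝 d)) :
    ∃ k ≤ M, ν = k ∧ d = headInd k ∧ HasLaw (chiTarget N k) (centeredGamma ν) P := by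
  have hdi := tendsto_pi_nhds.1 hd
  -- The `Nᵢ` do not depend on `n`, so the sums converge pointwise. Uniqueness of the limit law
  -- gives `chiSum N d` the Gamma law, and its moments can be compared without passing any moment to
  -- the limit.
  have hlim : TendstoInDistribution (fun n => chiSum N (c n)) atTop (chiSum N d) (fun _ => P) P := by
    refine tendstoInDistribution_of_ae_tendsto (fun n => aemeasurable_chiSum hN (c n))
      (aemeasurable_chiSum hN d) (Eventually.of_forall fun ω => ?_)
    exact tendsto_finsetSum _ fun i _ => (hdi i).mul_const _
  have hlaw : HasLaw (chiSum N d) (centeredGamma ν) P :=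
    ⟨aemeasurable_chiSum hN d, by rw [← hG.map_eq]; exact tendstoInDistribution_unique _ hlim hconv⟩
  have h2 : ∑ i, d i ^ 2 = ν := by
    refine tendsto_nhds_unique (tendsto_finsetSum _ fun i _ => (hdi i).pow 2) ?_
    simp_rw [hvar]
    exact tendsto_const_nhds
  have hanti : Antitone fun i => |d i| := fun i j hij =>
    le_of_tendsto_of_tendsto' (hdi j).abs (hdi i).abs fun n => hord n hij
  obtain ⟨-, -, -, m3, m4⟩ := moments_sum_chi hN hind d Finset.univ
  obtain ⟨g3, g4⟩ := moments_centeredGamma hν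
  have e : ∀ n : ℕ, ∫ ω, chiSum N d ω ^ n ∂P = ∫ x, x ^ n ∂(centeredGamma ν) := fun n =>
    hlaw.integral_comp (f := fun x : ℝ => x ^ n) (by fun_prop)
  have e3 := e 3
  have e4 := e 4
  simp only [chiSum] at e3 e4
  rw [m3, g3] at e3
  rw [m4, g4, h2] at e4
  obtain ⟨k, hk, rfl⟩ := exists_eq_headInd
    (eq_zero_or_one_of_sum_pow_eq (d := d) (by linarith) (by linarith)) hanti
  refine ⟨k, hk, ?_, rfl, ?_⟩
  · rw [← h2, sum_headInd_sq hk]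
  · rwa [← chiSum_headInd]

/-- Convergence in law forces `ν` to be an integer and the coefficients to converge. -/
theorem exists_tendsto_headInd (hν : 0 < ν)
    (hN : ∀ i, HasLaw (N i) (gaussianReal 0 1) P) (hind : iIndepFun N P) {c : ℕ → Fin M → ℝ}
    (hord : ∀ n, Antitone fun i => |c n i|) (hvar : ∀ n, ∑ i, c n i ^ 2 = ν)
    (hG : HasLaw G (centeredGamma ν) P')
    (hconv : TendstoInDistribution (fun n => chiSum N (c n)) atTop G (fun _ => P) P') :
    ∃ k : ℕ, 1 ≤ k ∧ k ≤ M ∧ ν = k ∧ HasLaw (chiTarget N k) (centeredGamma ν) P ∧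
      ∀ i, Tendsto (fun n => c n i) atTop (𝓝 (headInd k i)) := by
  have hcomp : IsCompact (Metric.closedBall (0 : Fin M → ℝ) (√ν)) := isCompact_closedBall _ _
  have hmem : ∀ n, c n ∈ Metric.closedBall (0 : Fin M → ℝ) (√ν) := by
    intro n
    rw [mem_closedBall_zero_iff, pi_norm_le_iff_of_nonneg (Real.sqrt_nonneg _)]
    intro i
    rw [Real.norm_eq_abs]
    apply Real.abs_le_sqrt
    rw [← hvar n]
    exact Finset.single_le_sum (f := fun i => c n i ^ 2) (fun _ _ => sq_nonneg _)
      (Finset.mem_univ i)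
  have key : ∀ ns : ℕ → ℕ, Tendsto ns atTop atTop → ∃ ms : ℕ → ℕ, ∃ k ≤ M, ν = k ∧
      HasLaw (chiTarget N k) (centeredGamma ν) P ∧
      Tendsto (fun n => c (ns (ms n))) atTop (𝓝 (headInd k)) := by
    intro ns hns
    obtain ⟨d, -, ms, hms, hd⟩ := hcomp.tendsto_subseq fun n => hmem (ns n)
    have hsub : Tendsto (fun n => ns (ms n)) atTop atTop := hns.comp hms.tendsto_atTop
    obtain ⟨k, hk, hνk, rfl, hlaw⟩ := exists_eq_headInd_of_tendsto
      (c := fun n => c (ns (ms n))) hν hN hind (fun n => hord _)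
      (fun n => hvar _) hG ⟨fun n => aemeasurable_chiSum hN _, hconv.aemeasurable_limit,
        hconv.tendsto.comp hsub⟩ hd
    exact ⟨ms, k, hk, hνk, hlaw, hd⟩
  obtain ⟨-, k, hk, hνk, hlaw, -⟩ := key id tendsto_id
  -- Every subsequence has a further one converging to some `headInd k'`, and `ν = k'` fixes `k' =
  -- k`; hence the whole sequence converges.
  refine ⟨k, ?_, hk, hνk, hlaw, tendsto_pi_nhds.1 (tendsto_of_subseq_tendsto fun ns hns => ?_)⟩
  · rw [hνk] at hν
    exact_mod_cast hν
  · obtain ⟨ms, k', -, hνk', -, h⟩ := key ns hns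
    have : k = k' := by
      rw [hνk] at hνk'
      exact_mod_cast hνk'
    subst this
    exact ⟨ms, h⟩

end Limit

/-! ### The `L²` distance to the target -/

section Distance

variable {M : ℕ} {k : ℕ} {c : Fin M → ℝ}

theorem sum_eq_head_add_tail (k : ℕ) (f : Fin M → ℝ) :
    ∑ i, f i = ∑ i with i.val < k, f i + ∑ i with k ≤ i.val, f i := by
  rw [← Finset.sum_filter_add_sum_filter_not Finset.univ fun i : Fin M => i.val < k]
  simp only [not_lt]

theorem sum_sub_headInd_sq (k : ℕ) (c : Fin M → ℝ) :
    ∑ i, (c i - headInd k i) ^ 2 = headSq k c + thetaRate k c := by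
  rw [sum_eq_head_add_tail k, headSq, thetaRate]
  congr 1 <;> refine Finset.sum_congr rfl fun i hi => ?_
  · rw [headInd, if_pos (Finset.mem_filter.1 hi).2]
    ring
  · rw [headInd, if_neg (not_lt.2 (Finset.mem_filter.1 hi).2)]
    ring

theorem chiSum_sub_chiTarget {Ω : Type*} (N : Fin M → Ω → ℝ) (k : ℕ) (c : Fin M → ℝ) :
    chiSum N c - chiTarget N k = chiSum N fun i => c i - headInd k i := by
  rw [← chiSum_headInd]
  ext ω
  simp [chiSum, sub_mul, Finset.sum_sub_distrib]

theorem thetaRate_nonneg : 0 ≤ thetaRate k c := Finset.sum_nonneg fun _ _ => sq_nonneg _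

theorem headSq_nonneg : 0 ≤ headSq k c := Finset.sum_nonneg fun _ _ => sq_nonneg _

theorem omegaRate_nonneg : 0 ≤ omegaRate k c := Real.iSup_nonneg fun _ => abs_nonneg _

theorem abs_one_sub_le_omegaRate {i : Fin M} (hi : i.val < k) : |1 - c i| ≤ omegaRate k c :=
  le_ciSup (f := fun i : {i : Fin M // i.val < k} => |1 - c i|) (Set.finite_range _).bddAbove
    ⟨i, hi⟩

theorem exists_omegaRate_eq (hk : 1 ≤ k) (hkM : k ≤ M) (c : Fin M → ℝ) :
    ∃ i : Fin M, i.val < k ∧ omegaRate k c = |1 - c i| := by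
  have : Nonempty {i : Fin M // i.val < k} := ⟨⟨⟨0, by omega⟩, hk⟩⟩
  obtain ⟨i, hi⟩ := exists_eq_ciSup_of_finite (f := fun i : {i : Fin M // i.val < k} => |1 - c i|)
  exact ⟨i, i.2, hi.symm⟩

theorem card_head (hkM : k ≤ M) : (Finset.univ.filter fun i : Fin M => i.val < k).card = k := by
  rw [Fin.card_filter_val_lt, min_eq_right hkM]

theorem omegaRate_sq_le_headSq (hk : 1 ≤ k) (hkM : k ≤ M) : omegaRate k c ^ 2 ≤ headSq k c := by
  obtain ⟨i, hi, h⟩ := exists_omegaRate_eq hk hkM c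
  rw [h, sq_abs]
  exact Finset.single_le_sum (f := fun i => (1 - c i) ^ 2) (fun _ _ => sq_nonneg _)
    (by simpa using hi)

theorem headSq_le (hkM : k ≤ M) : headSq k c ≤ k * omegaRate k c ^ 2 := by
  have h := Finset.sum_le_card_nsmul (Finset.univ.filter fun i : Fin M => i.val < k)
    (fun i => (1 - c i) ^ 2) (omegaRate k c ^ 2) fun i hi => by
      rw [← sq_abs]
      exact pow_le_pow_left₀ (abs_nonneg _) (abs_one_sub_le_omegaRate (Finset.mem_filter.1 hi).2) 2
  rwa [card_head hkM, nsmul_eq_mul] at h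

/-- The normalization of the variances expressed through the deviations from the target. -/
theorem two_mul_sum_one_sub (hkM : k ≤ M) (hvar : ∑ i, c i ^ 2 = (k : ℝ)) :
    2 * ∑ i with i.val < k, (1 - c i) = headSq k c + thetaRate k c := by
  rw [sum_eq_head_add_tail k] at hvar
  have h : ∑ i with i.val < k, c i ^ 2 =
      k - 2 * ∑ i with i.val < k, (1 - c i) + headSq k c := by
    have : ∀ i, c i ^ 2 = 1 - 2 * (1 - c i) + (1 - c i) ^ 2 := fun i => by ring
    simp_rw [this]
    rw [Finset.sum_add_distrib, Finset.sum_sub_distrib, ← Finset.mul_sum, Finset.sum_const,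
      card_head hkM, headSq, nsmul_eq_mul, mul_one]
  rw [thetaRate]
  linarith

/-- A quadratic quantity bounded linearly by `ω`: this gives `ϑ = O(ω)`, and `ϑ = 0` whenever `ω =
0`. -/
theorem headSq_add_thetaRate_le (hkM : k ≤ M) (hvar : ∑ i, c i ^ 2 = (k : ℝ)) :
    headSq k c + thetaRate k c ≤ 2 * k * omegaRate k c := by
  rw [← two_mul_sum_one_sub hkM hvar]
  have h := Finset.sum_le_card_nsmul (Finset.univ.filter fun i : Fin M => i.val < k)
    (fun i => 1 - c i) (omegaRate k c) fun i hi =>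
      (le_abs_self _).trans (abs_one_sub_le_omegaRate (Finset.mem_filter.1 hi).2)
  rw [card_head hkM, nsmul_eq_mul] at h
  linarith

/-- For at most two head coefficients the head square sum is determined by the linear sum. -/
theorem headSq_eq_of_le_two (hk : 1 ≤ k) (hk2 : k ≤ 2) (hkM : k ≤ M)
    (hvar : ∑ i, c i ^ 2 = (k : ℝ)) :
    headSq k c = omegaRate k c ^ 2 + ((headSq k c + thetaRate k c) / 2 - omegaRate k c) ^ 2 := by
  have hS := two_mul_sum_one_sub hkM hvar
  have hle := omegaRate_sq_le_headSq (c := c) hk hkM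
  have hθ := thetaRate_nonneg (k := k) (c := c)
  have hω := omegaRate_nonneg (k := k) (c := c)
  obtain ⟨i, hi, h⟩ := exists_omegaRate_eq hk hkM c
  have hmem : i ∈ Finset.univ.filter fun i : Fin M => i.val < k := by simpa using hi
  have hH : headSq k c = (1 - c i) ^ 2 +
      ∑ j ∈ (Finset.univ.filter fun i : Fin M => i.val < k).erase i, (1 - c j) ^ 2 :=
    (Finset.add_sum_erase _ _ hmem).symm
  rw [← Finset.add_sum_erase _ _ hmem] at hS
  have hcard : ((Finset.univ.filter fun i : Fin M => i.val < k).erase i).card = k - 1 := by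
    rw [Finset.card_erase_of_mem hmem, card_head hkM]
  -- `y` is the other head deviation, or `0` when `k = 1`.
  have hother : ∃ y : ℝ, |y| ≤ omegaRate k c ∧ headSq k c = (1 - c i) ^ 2 + y ^ 2 ∧
      2 * ((1 - c i) + y) = headSq k c + thetaRate k c := by
    obtain rfl | rfl : k = 1 ∨ k = 2 := by omega
    · rw [Finset.card_eq_zero.1 hcard] at hS hH
      exact ⟨0, by simpa using hω, by simpa using hH, by simpa using hS⟩
    · obtain ⟨j, hj⟩ := Finset.card_eq_one.1 hcard
      have hj2 : j ∈ (Finset.univ.filter fun i : Fin M => i.val < 2).erase i := by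
        rw [hj]
        exact Finset.mem_singleton_self j
      rw [hj, Finset.sum_singleton] at hS hH
      exact ⟨1 - c j, abs_one_sub_le_omegaRate
        (Finset.mem_filter.1 (Finset.mem_of_mem_erase hj2)).2, hH, hS⟩
  obtain ⟨y, hy, hHy, hSy⟩ := hother
  have hy' := abs_le.1 hy
  -- The sum of the two deviations is nonnegative, so the one of largest modulus cannot be negative.
  -- Hence it equals `ω`, and `y = (H + ϑ) / 2 - ω`.
  have hxω : 1 - c i = omegaRate k c := by
    rcases abs_choice (1 - c i) with h' | h'
    · rw [h, h']
    · rw [h'] at h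
      have : omegaRate k c ^ 2 ≤ 0 := by nlinarith
      have h0 : omegaRate k c = 0 := by nlinarith
      linarith
  rw [← hSy]
  nlinarith

end Distance

end

end GammaApprox

namespace GammaApprox

noncomputable section

/-! ### Comparison of the rates -/

/-- The relations between the two rates `ω` and `ϑ`, the square sum `H` of the deviations of the
leading coefficients, and the two variances. -/
structure RateSystem (K : ℝ) (ω θ H V₁ V₃ : ℕ → ℝ) : Prop where
  omega_nonneg : ∀ n, 0 ≤ ω n
  theta_nonneg : ∀ n, 0 ≤ θ n
  sq_le : ∀ n, ω n ^ 2 ≤ H n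
  le_sq : ∀ n, H n ≤ K * ω n ^ 2
  add_le : ∀ n, H n + θ n ≤ 2 * K * ω n
  tendsto_omega : Tendsto ω atTop (𝓝 0)
  equiv_one : V₁ ~[atTop] fun n => 8 * (H n + θ n)
  equiv_three : V₃ ~[atTop] fun n => 128 * H n

namespace RateSystem

variable {K : ℝ} {ω θ H V₁ V₃ : ℕ → ℝ}

theorem head_nonneg (h : RateSystem K ω θ H V₁ V₃) (n : ℕ) : 0 ≤ H n :=
  (sq_nonneg _).trans (h.sq_le n)

theorem theta_eq_zero (h : RateSystem K ω θ H V₁ V₃) {n : ℕ} (hn : ω n = 0) : θ n = 0 := by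
  have h1 := h.add_le n
  have h2 := h.head_nonneg n
  have h3 := h.theta_nonneg n
  rw [hn, mul_zero] at h1
  linarith

theorem head_isTheta (h : RateSystem K ω θ H V₁ V₃) : H =Θ[atTop] fun n => ω n ^ 2 := by
  refine ⟨IsBigO.of_bound K (Eventually.of_forall fun n => ?_),
    IsBigO.of_bound 1 (Eventually.of_forall fun n => ?_)⟩
  · rw [Real.norm_of_nonneg (h.head_nonneg n), Real.norm_of_nonneg (sq_nonneg _)]
    exact h.le_sq n
  · rw [Real.norm_of_nonneg (h.head_nonneg n), Real.norm_of_nonneg (sq_nonneg _), one_mul]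
    exact h.sq_le n

theorem head_isLittleO (h : RateSystem K ω θ H V₁ V₃) : H =o[atTop] ω := by
  refine h.head_isTheta.1.trans_isLittleO ?_
  have h1 : ω =o[atTop] fun _ => (1 : ℝ) := (isLittleO_one_iff ℝ).2 h.tendsto_omega
  simpa [sq] using h1.mul_isBigO (isBigO_refl ω atTop)

theorem one_isTheta (h : RateSystem K ω θ H V₁ V₃) : V₁ =Θ[atTop] fun n => H n + θ n :=
  h.equiv_one.isTheta.trans ((isTheta_const_mul_left (by norm_num)).2 isTheta_rfl)

theorem three_isTheta (h : RateSystem K ω θ H V₁ V₃) : V₃ =Θ[atTop] fun n => ω n ^ 2 :=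
  (h.equiv_three.isTheta.trans ((isTheta_const_mul_left (by norm_num)).2 isTheta_rfl)).trans
    h.head_isTheta

/-- Since `V₃` has order `ω²` and `V₁` order `H + θ`, taking square roots leaves the comparison of
`H + θ` with `ω`, where `H = o(ω)` is negligible. -/
theorem three_isTheta_sq_iff (h : RateSystem K ω θ H V₁ V₃) :
    V₃ =Θ[atTop] (fun n => V₁ n ^ 2) ↔ θ =Θ[atTop] ω := by
  have h1 : V₃ =Θ[atTop] (fun n => V₁ n ^ 2) ↔ (fun n => H n + θ n) =Θ[atTop] ω := by
    constructor
    · intro h'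
      have h2 := (h.three_isTheta.symm.trans h').trans (h.one_isTheta.pow 2)
      exact ⟨h2.2.of_pow two_ne_zero, h2.1.of_pow two_ne_zero⟩
    · intro h'
      exact h.three_isTheta.trans ((h.one_isTheta.trans h').pow 2).symm
  rw [h1]
  constructor
  · intro h'
    have e : ((fun n => H n + θ n) + fun n => -H n) = θ := by
      ext n
      simp
    exact e ▸ h'.add_isLittleO h.head_isLittleO.neg_left
  · intro h'
    have e : (θ + H) = fun n => H n + θ n := by
      ext n
      exact add_comm _ _
    exact e ▸ h'.add_isLittleO h.head_isLittleO

/-- The question is whether `H + θ` has order `ω²`. The lower bound is automatic from `H ≥ ω²`, so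
only an upper bound on `θ` is needed. -/
theorem three_isTheta_iff (h : RateSystem K ω θ H V₁ V₃) :
    V₃ =Θ[atTop] V₁ ↔ θ =O[atTop] fun n => ω n ^ 2 := by
  constructor
  · intro h'
    have h2 := (h.one_isTheta.symm.trans (h'.symm.trans h.three_isTheta)).1
    exact (h2.sub h.head_isTheta.1).congr_left fun n => by ring
  · intro h'
    refine ⟨?_, h.one_isTheta.1.trans ((h.head_isTheta.1.add h').trans h.three_isTheta.2)⟩
    refine h.three_isTheta.1.trans (IsBigO.trans ?_ h.one_isTheta.2)
    refine IsBigO.of_bound 1 (Eventually.of_forall fun n => ?_)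
    have h1 := h.head_nonneg n
    have h2 := h.theta_nonneg n
    rw [Real.norm_of_nonneg (sq_nonneg _), Real.norm_of_nonneg (by linarith), one_mul]
    linarith [h.sq_le n]

theorem isTheta_or_isLittleO_of_isBigO (h : RateSystem K ω θ H V₁ V₃) {l : ENNReal}
    (hl : Tendsto (fun n => ENNReal.ofReal (θ n) / ENNReal.ofReal (ω n ^ 2)) atTop (𝓝 l))
    (hO : θ =O[atTop] fun n => ω n ^ 2) :
    θ =Θ[atTop] (fun n => ω n ^ 2) ∨ θ =o[atTop] fun n => ω n ^ 2 := by
  have hzero : ∀ n, ω n ^ 2 = 0 → θ n = 0 := fun n hn =>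
    h.theta_eq_zero (pow_eq_zero_iff two_ne_zero |>.1 hn)
  -- When `ω = 0` also `θ = 0`, and both divisions return `0`.
  have hr : ∀ n, ENNReal.ofReal (θ n) / ENNReal.ofReal (ω n ^ 2) =
      ENNReal.ofReal (θ n / ω n ^ 2) := by
    intro n
    rcases (sq_nonneg (ω n)).eq_or_lt with hn | hn
    · rw [hzero n hn.symm]
      simp
    · rw [ENNReal.ofReal_div_of_pos hn]
  simp_rw [hr] at hl
  obtain ⟨C, hC⟩ := hO.bound
  have hle : l ≤ ENNReal.ofReal (max C 0) := by
    refine le_of_tendsto hl (hC.mono fun n hn => ENNReal.ofReal_le_ofReal ?_)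
    rw [Real.norm_of_nonneg (h.theta_nonneg n), Real.norm_of_nonneg (sq_nonneg _)] at hn
    rcases (sq_nonneg (ω n)).eq_or_lt with h0 | h0
    · rw [← h0, div_zero]
      exact le_max_right _ _
    · exact (div_le_of_le_mul₀ h0.le (le_max_right _ _)
        (hn.trans (mul_le_mul_of_nonneg_right (le_max_left _ _) h0.le)))
  have htop : l ≠ ⊤ := ne_top_of_le_ne_top ENNReal.ofReal_ne_top hle
  have hreal : Tendsto (fun n => θ n / ω n ^ 2) atTop (𝓝 l.toReal) := by
    refine ((ENNReal.tendsto_toReal htop).comp hl).congr fun n => ?_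
    exact ENNReal.toReal_ofReal (div_nonneg (h.theta_nonneg n) (sq_nonneg _))
  by_cases h0 : l.toReal = 0
  · right
    rw [h0] at hreal
    exact (isLittleO_iff_tendsto hzero).2 hreal
  · left
    exact (isTheta_of_div_tendsto_nhds_ne_zero hreal h0).symm

/-! #### Ratios with a limit -/

theorem eventually_pos (h : RateSystem K ω θ H V₁ V₃) (hω : ∀ᶠ n in atTop, ω n ≠ 0) :
    ∀ᶠ n in atTop, 0 < ω n :=
  hω.mono fun n hn => lt_of_le_of_ne (h.omega_nonneg n) hn.symm

/-- This is `H / ω → 0`, factored through the bounded ratio `H / ω²`. -/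
theorem tendsto_head_div_mul (h : RateSystem K ω θ H V₁ V₃) :
    Tendsto (fun n => H n / ω n ^ 2 * ω n) atTop (𝓝 0) := by
  refine squeeze_zero (g := fun n => |K| * ω n) (fun n => ?_) (fun n => ?_) ?_
  · exact mul_nonneg (div_nonneg (h.head_nonneg n) (sq_nonneg _)) (h.omega_nonneg n)
  · refine mul_le_mul_of_nonneg_right ?_ (h.omega_nonneg n)
    refine div_le_of_le_mul₀ (sq_nonneg _) (abs_nonneg _) ((h.le_sq n).trans ?_)
    exact mul_le_mul_of_nonneg_right (le_abs_self K) (sq_nonneg _)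
  · simpa using h.tendsto_omega.const_mul |K|

theorem one_le_head_div (h : RateSystem K ω θ H V₁ V₃) (hω : ∀ᶠ n in atTop, ω n ≠ 0) :
    ∀ᶠ n in atTop, 1 ≤ H n / ω n ^ 2 := by
  filter_upwards [h.eventually_pos hω] with n hn
  rw [one_le_div (by positivity)]
  exact h.sq_le n

theorem approxC_theta_iff (h : RateSystem K ω θ H V₁ V₃) (hω : ∀ᶠ n in atTop, ω n ≠ 0) :
    ApproxC θ ω ↔ ∃ C : ℝ, 0 < C ∧ Tendsto (fun n => (H n + θ n) / (2 * ω n)) atTop (𝓝 C) := by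
  have hH := h.tendsto_head_div_mul
  constructor
  · rintro ⟨C, hC, hlim⟩
    refine ⟨C / 2, by positivity, ?_⟩
    have h1 := (hlim.add hH).div_const 2
    rw [add_zero] at h1
    refine h1.congr' ?_
    filter_upwards [hω] with n hn
    field_simp
    ring
  · rintro ⟨C, hC, hlim⟩
    refine ⟨2 * C, by positivity, ?_⟩
    have h1 := (hlim.const_mul 2).sub hH
    rw [sub_zero] at h1
    refine h1.congr' ?_
    filter_upwards [hω] with n hn
    field_simp
    ring

theorem approxC_three_sq_iff (h : RateSystem K ω θ H V₁ V₃) (hω : ∀ᶠ n in atTop, ω n ≠ 0) :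
    ApproxC V₃ (fun n => V₁ n ^ 2) ↔ ∃ C : ℝ, 0 < C ∧
      Tendsto (fun n => H n / ω n ^ 2 / ((H n + θ n) / (2 * ω n)) ^ 2) atTop (𝓝 C) := by
  have heq : (fun n => V₃ n / V₁ n ^ 2) ~[atTop]
      fun n => 128 * H n / (8 * (H n + θ n)) ^ 2 := h.equiv_three.div (h.equiv_one.pow 2)
  have hne : ∀ᶠ n in atTop, 128 * H n / (8 * (H n + θ n)) ^ 2 =
      1 / 2 * (H n / ω n ^ 2 / ((H n + θ n) / (2 * ω n)) ^ 2) := by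
    filter_upwards [h.eventually_pos hω] with n hn
    have h1 : 0 < H n := lt_of_lt_of_le (by positivity) (h.sq_le n)
    have h2 : 0 < H n + θ n := add_pos_of_pos_of_nonneg h1 (h.theta_nonneg n)
    field_simp
    norm_num
  constructor
  · rintro ⟨C, hC, hlim⟩
    refine ⟨2 * C, by positivity, ?_⟩
    refine (((heq.tendsto_nhds_iff.1 hlim).congr' hne).const_mul 2).congr fun n => ?_
    ring
  · rintro ⟨C, hC, hlim⟩
    refine ⟨1 / 2 * C, by positivity, heq.tendsto_nhds_iff.2 ?_⟩
    exact (hlim.const_mul (1 / 2)).congr' (hne.mono fun n hn => hn.symm)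

theorem approxC_three_iff (h : RateSystem K ω θ H V₁ V₃) (hω : ∀ᶠ n in atTop, ω n ≠ 0) :
    ApproxC V₃ V₁ ↔ ∃ C : ℝ, 0 < C ∧
      Tendsto (fun n => H n / ω n ^ 2 / (H n / ω n ^ 2 + θ n / ω n ^ 2)) atTop (𝓝 C) := by
  have heq : (fun n => V₃ n / V₁ n) ~[atTop]
      fun n => 128 * H n / (8 * (H n + θ n)) := h.equiv_three.div h.equiv_one
  have hne : ∀ᶠ n in atTop, 128 * H n / (8 * (H n + θ n)) =
      16 * (H n / ω n ^ 2 / (H n / ω n ^ 2 + θ n / ω n ^ 2)) := by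
    filter_upwards [h.eventually_pos hω] with n hn
    have h1 : 0 < H n := lt_of_lt_of_le (by positivity) (h.sq_le n)
    have h2 : 0 < H n + θ n := add_pos_of_pos_of_nonneg h1 (h.theta_nonneg n)
    rw [← add_div]
    field_simp
    norm_num
  constructor
  · rintro ⟨C, hC, hlim⟩
    refine ⟨1 / 16 * C, by positivity, ?_⟩
    refine (((heq.tendsto_nhds_iff.1 hlim).congr' hne).const_mul (1 / 16)).congr fun n => ?_
    ring
  · rintro ⟨C, hC, hlim⟩
    refine ⟨16 * C, by positivity, heq.tendsto_nhds_iff.2 ?_⟩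
    exact (hlim.const_mul 16).congr' (hne.mono fun n hn => hn.symm)

/-- With `a = H / ω²` and `w = (H + θ) / (2ω)`, the claim is that `a / w²` has a positive limit
exactly when `w` does. If `a` converges this is immediate; otherwise `a = 1 + (w - 1)²` and `a / w²`
must be inverted as a function of `w`. -/
theorem approxC_three_sq_iff_theta (h : RateSystem K ω θ H V₁ V₃)
    (hω : ∀ᶠ n in atTop, ω n ≠ 0)
    (hcase : (K ≤ 2 ∧ ∀ n, H n = ω n ^ 2 + ((H n + θ n) / 2 - ω n) ^ 2) ∨
      ∃ s : ℝ, Tendsto (fun n => H n / ω n ^ 2) atTop (𝓝 s)) :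
    ApproxC V₃ (fun n => V₁ n ^ 2) ↔ ApproxC θ ω := by
  rw [h.approxC_three_sq_iff hω, h.approxC_theta_iff hω]
  set a : ℕ → ℝ := fun n => H n / ω n ^ 2 with ha
  set w : ℕ → ℝ := fun n => (H n + θ n) / (2 * ω n) with hw
  have hpos := h.eventually_pos hω
  have ha1 : ∀ᶠ n in atTop, 1 ≤ a n := h.one_le_head_div hω
  have hw0 : ∀ n, 0 ≤ w n := fun n => div_nonneg
    (add_nonneg (h.head_nonneg n) (h.theta_nonneg n)) (mul_nonneg zero_le_two (h.omega_nonneg n))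
  have hback : ∀ s C : ℝ, Tendsto a atTop (𝓝 s) → 0 < C → Tendsto w atTop (𝓝 C) →
      ∃ C : ℝ, 0 < C ∧ Tendsto (fun n => a n / w n ^ 2) atTop (𝓝 C) := fun s C hs hC hlim =>
    have hs1 : 1 ≤ s := ge_of_tendsto hs ha1
    ⟨s / C ^ 2, by positivity, hs.div (hlim.pow 2) (by positivity)⟩
  rcases hcase with ⟨hK, hquad⟩ | ⟨s, hs⟩
  · have haw : ∀ᶠ n in atTop, a n = 1 + (w n - 1) ^ 2 := by
      filter_upwards [hpos] with n hn
      simp only [ha, hw]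
      field_simp
      linear_combination 4 * hquad n
    constructor
    · rintro ⟨C, hC, hlim⟩
      -- Division by zero returns `0`, so a positive limit excludes `w = 0`.
      have hwne : ∀ᶠ n in atTop, 0 < w n := by
        filter_upwards [hlim.eventually (lt_mem_nhds hC)] with n hn
        refine lt_of_le_of_ne (hw0 n) fun h0 => ?_
        change 0 < a n / w n ^ 2 at hn
        rw [← h0] at hn
        norm_num at hn
      -- Completing the square, `a / w² = 2 (1/w - 1/2)² + 1/2`. Here `K ≤ 2` forces `w ≤ 2`, so
      -- `1/w - 1/2` is the nonnegative root.
      have hz : Tendsto (fun n => √((a n / w n ^ 2 - 1 / 2) / 2)) atTop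
          (𝓝 √((C - 1 / 2) / 2)) := ((hlim.sub_const _).div_const _).sqrt
      have hsum : 0 < 1 / 2 + √((C - 1 / 2) / 2) := by positivity
      refine ⟨(1 / 2 + √((C - 1 / 2) / 2))⁻¹, by positivity,
        ((hz.const_add (1 / 2)).inv₀ hsum.ne').congr' ?_⟩
      filter_upwards [hwne, haw, hpos] with n hn hna hnω
      have hw2 : w n ≤ 2 := by
        simp only [hw]
        rw [div_le_iff₀ (by positivity)]
        nlinarith [h.add_le n]
      have hzn : 0 ≤ (w n)⁻¹ - 1 / 2 := by
        have := inv_anti₀ hn hw2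
        linarith
      have : (a n / w n ^ 2 - 1 / 2) / 2 = ((w n)⁻¹ - 1 / 2) ^ 2 := by
        rw [hna]
        field_simp
        ring
      rw [this, Real.sqrt_sq hzn]
      simp
    · rintro ⟨C, hC, hlim⟩
      exact hback _ C ((((hlim.sub_const 1).pow 2).const_add 1).congr'
        (haw.mono fun n hn => hn.symm)) hC hlim
  · constructor
    · rintro ⟨C, hC, hlim⟩
      have hs1 : 1 ≤ s := ge_of_tendsto hs ha1
      refine ⟨√(s / C), by positivity, (hs.div hlim hC.ne').sqrt.congr' ?_⟩
      filter_upwards [ha1] with n hn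
      have : a n ≠ 0 := by positivity
      rw [Pi.div_apply, div_div_cancel₀ this, Real.sqrt_sq (hw0 n)]
    · rintro ⟨C, hC, hlim⟩
      exact hback s C hs hC hlim

theorem approxC_three_iff_theta (h : RateSystem K ω θ H V₁ V₃)
    (hω : ∀ᶠ n in atTop, ω n ≠ 0)
    (hcase : (∀ n, H n = ω n ^ 2 + ((H n + θ n) / 2 - ω n) ^ 2) ∨
      ∃ s : ℝ, Tendsto (fun n => H n / ω n ^ 2) atTop (𝓝 s)) :
    ApproxC V₃ V₁ ↔ ApproxC θ (fun n => ω n ^ 2) ∨ θ =o[atTop] fun n => ω n ^ 2 := by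
  have hpos := h.eventually_pos hω
  have ha1 := h.one_le_head_div hω
  have hzero : ∀ n, ω n ^ 2 = 0 → θ n = 0 := fun n hn =>
    h.theta_eq_zero (pow_eq_zero_iff two_ne_zero |>.1 hn)
  -- The two alternatives are a positive and a zero limit, so together they say that `θ / ω²` has a
  -- finite limit.
  have hR : (ApproxC θ (fun n => ω n ^ 2) ∨ θ =o[atTop] fun n => ω n ^ 2) ↔
      ∃ L : ℝ, Tendsto (fun n => θ n / ω n ^ 2) atTop (𝓝 L) := by
    rw [isLittleO_iff_tendsto hzero]
    constructor
    · rintro (⟨C, -, hC⟩ | h0)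
      exacts [⟨C, hC⟩, ⟨0, h0⟩]
    · rintro ⟨L, hL⟩
      have hL0 : 0 ≤ L := ge_of_tendsto' hL fun n => div_nonneg (h.theta_nonneg n) (sq_nonneg _)
      rcases hL0.eq_or_lt with rfl | hL0
      exacts [Or.inr hL, Or.inl ⟨L, hL0, hL⟩]
  rw [hR, h.approxC_three_iff hω]
  -- Either side of the equivalence forces `(H + θ) / ω → 0`; then `H / ω² = 1 + ((H + θ) / (2ω) -
  -- 1)²` tends to `2`.
  have hquadlim : (∀ n, H n = ω n ^ 2 + ((H n + θ n) / 2 - ω n) ^ 2) →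
      Tendsto (fun n => (H n / ω n ^ 2 + θ n / ω n ^ 2) * ω n) atTop (𝓝 0) →
      Tendsto (fun n => H n / ω n ^ 2) atTop (𝓝 2) := by
    intro hquad hlim
    have h1 := (((hlim.div_const 2).sub_const 1).pow 2).const_add 1
    norm_num at h1
    refine h1.congr' ?_
    filter_upwards [hpos] with n hn
    field_simp
    linear_combination -4 * hquad n
  constructor
  · rintro ⟨C, hC, hlim⟩
    have hq : Tendsto (fun n => (H n / ω n ^ 2 + θ n / ω n ^ 2) / (H n / ω n ^ 2)) atTop
        (𝓝 C⁻¹) := (hlim.inv₀ hC.ne').congr fun n => by rw [inv_div]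
    obtain ⟨s, hs⟩ : ∃ s : ℝ, Tendsto (fun n => H n / ω n ^ 2) atTop (𝓝 s) := by
      rcases hcase with hquad | hs
      · refine ⟨2, hquadlim hquad ?_⟩
        have h1 := hq.mul h.tendsto_head_div_mul
        rw [mul_zero] at h1
        refine h1.congr' ?_
        filter_upwards [ha1] with n hn
        rw [← mul_assoc, div_mul_cancel₀ _ (by positivity)]
      · exact hs
    refine ⟨C⁻¹ * s - s, ((hq.mul hs).sub hs).congr' ?_⟩
    filter_upwards [ha1] with n hn
    rw [div_mul_cancel₀ _ (by positivity)]
    ring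
  · rintro ⟨L, hL⟩
    have hL0 : 0 ≤ L := ge_of_tendsto' hL fun n => div_nonneg (h.theta_nonneg n) (sq_nonneg _)
    obtain ⟨s, hs⟩ : ∃ s : ℝ, Tendsto (fun n => H n / ω n ^ 2) atTop (𝓝 s) := by
      rcases hcase with hquad | hs
      · refine ⟨2, hquadlim hquad ?_⟩
        have h1 := h.tendsto_head_div_mul.add (hL.mul h.tendsto_omega)
        rw [mul_zero, add_zero] at h1
        exact h1.congr fun n => by ring
      · exact hs
    have hs1 : 1 ≤ s := ge_of_tendsto hs ha1
    exact ⟨s / (s + L), by positivity, hs.div (hs.add hL) (by positivity)⟩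

end RateSystem

/-- Sequences of the same order with the same zeros are comparable with uniform constants. -/
theorem exists_bounds_of_isTheta {a b : ℕ → ℝ} (ha : ∀ n, 0 ≤ a n) (hb : ∀ n, 0 ≤ b n)
    (hab : ∀ n, a n = 0 ↔ b n = 0) (h : a =Θ[atTop] b) :
    ∃ C₁ C₂ : ℝ, 0 < C₁ ∧ C₁ < C₂ ∧ ∀ n, C₁ * b n ≤ a n ∧ a n ≤ C₂ * b n := by
  have key : ∀ {f g : ℕ → ℝ}, (∀ n, 0 ≤ f n) → (∀ n, 0 ≤ g n) → (∀ n, g n = 0 → f n = 0) →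
      f =O[atTop] g → ∃ C : ℝ, 0 < C ∧ ∀ n, f n ≤ C * g n := by
    intro f g hf hg hfg hO
    obtain ⟨C, hC, hbound⟩ := bound_of_isBigO_nat_atTop hO
    refine ⟨C, hC, fun n => ?_⟩
    by_cases hn : g n = 0
    · rw [hfg n hn, hn, mul_zero]
    · have := hbound hn
      rwa [Real.norm_of_nonneg (hf n), Real.norm_of_nonneg (hg n)] at this
  obtain ⟨C, hC, h1⟩ := key ha hb (fun n => (hab n).2) h.1
  obtain ⟨D, hD, h2⟩ := key hb ha (fun n => (hab n).1) h.2
  -- The maximum only ensures that the two constants are strictly ordered.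
  refine ⟨D⁻¹, max C (D⁻¹ + 1), by positivity, lt_of_lt_of_le (lt_add_one _) (le_max_right _ _),
    fun n => ⟨?_, ?_⟩⟩
  · rw [inv_mul_le_iff₀ hD]
    exact h2 n
  · exact (h1 n).trans (mul_le_mul_of_nonneg_right (le_max_left _ _) (hb n))

/-! ### Asymptotics of the power sums -/

section Coefficients

variable {M k : ℕ} {c : ℕ → Fin M → ℝ}

theorem isEquivalent_sum_sq_mul
    (hlim : ∀ i, Tendsto (fun n => c n i) atTop (𝓝 (headInd k i))) :
    (fun n => ∑ i, c n i ^ 2 * (1 - c n i) ^ 2) ~[atTop]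
      fun n => headSq k (c n) + thetaRate k (c n) := by
  -- In `cᵢ²(1 - cᵢ)²` one factor is the squared deviation from the limit and the other, `(cᵢ - (1 -
  -- headInd k i))²`, tends to 1 for head and tail alike.
  have hsub : ∀ n, ∑ i, c n i ^ 2 * (1 - c n i) ^ 2 - (headSq k (c n) + thetaRate k (c n)) =
      ∑ i, ((c n i - (1 - headInd k i)) ^ 2 - 1) * (c n i - headInd k i) ^ 2 := by
    intro n
    rw [← sum_sub_headInd_sq, ← Finset.sum_sub_distrib]
    refine Finset.sum_congr rfl fun i _ => ?_
    unfold headInd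
    split_ifs <;> ring
  refine (IsLittleO.fun_sum (s := Finset.univ)
    (A := fun i n => ((c n i - (1 - headInd k i)) ^ 2 - 1) * (c n i - headInd k i) ^ 2)
    fun i _ => ?_).congr_left fun n => (hsub n).symm
  have h1 : (fun n => (c n i - (1 - headInd k i)) ^ 2 - 1) =o[atTop] fun _ => (1 : ℝ) := by
    rw [isLittleO_one_iff]
    have := (((hlim i).sub_const (1 - headInd k i)).pow 2).sub_const 1
    convert this using 2
    unfold headInd
    split_ifs <;> norm_num
  have h2 : (fun n => (c n i - headInd k i) ^ 2) =O[atTop]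
      fun n => headSq k (c n) + thetaRate k (c n) := by
    refine IsBigO.of_bound 1 (Eventually.of_forall fun n => ?_)
    rw [Real.norm_of_nonneg (sq_nonneg _), one_mul, ← sum_sub_headInd_sq]
    exact (Finset.single_le_sum (f := fun i => (c n i - headInd k i) ^ 2)
      (fun _ _ => sq_nonneg _) (Finset.mem_univ i)).trans (le_abs_self _)
  simpa using h1.mul_isBigO h2

theorem isEquivalent_sum_pow_six_mul (hk : 1 ≤ k) (hkM : k ≤ M)
    (hvar : ∀ n, ∑ i, c n i ^ 2 = (k : ℝ))
    (hlim : ∀ i, Tendsto (fun n => c n i) atTop (𝓝 (headInd k i))) :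
    (fun n => ∑ i, c n i ^ 6 * (1 - c n i) ^ 2) ~[atTop] fun n => headSq k (c n) := by
  have hsub : ∀ n, ∑ i, c n i ^ 6 * (1 - c n i) ^ 2 - headSq k (c n) =
      ∑ i, (c n i ^ 6 - headInd k i) * (1 - c n i) ^ 2 := by
    intro n
    have : headSq k (c n) = ∑ i, headInd k i * (1 - c n i) ^ 2 := by
      simp [headSq, headInd, Finset.sum_filter]
    rw [this, ← Finset.sum_sub_distrib]
    exact Finset.sum_congr rfl fun i _ => by ring
  refine (IsLittleO.fun_sum (s := Finset.univ)
    (A := fun i n => (c n i ^ 6 - headInd k i) * (1 - c n i) ^ 2)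
    fun i _ => ?_).congr_left fun n => (hsub n).symm
  have hi := hlim i
  by_cases hik : i.val < k
  · simp only [headInd, if_pos hik] at hi ⊢
    have h1 : (fun n => c n i ^ 6 - 1) =o[atTop] fun _ => (1 : ℝ) := by
      rw [isLittleO_one_iff]
      simpa using (hi.pow 6).sub_const 1
    have h2 : (fun n => (1 - c n i) ^ 2) =O[atTop] fun n => headSq k (c n) := by
      refine IsBigO.of_bound 1 (Eventually.of_forall fun n => ?_)
      rw [Real.norm_of_nonneg (sq_nonneg _), one_mul]
      exact (Finset.single_le_sum (f := fun i => (1 - c n i) ^ 2)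
        (fun _ _ => sq_nonneg _) (by simpa using hik)).trans (le_abs_self _)
    simpa using h1.mul_isBigO h2
  · simp only [headInd, if_neg hik] at hi ⊢
    have h1 : (fun n => c n i ^ 2 * (1 - c n i) ^ 2) =o[atTop] fun _ => (1 : ℝ) := by
      rw [isLittleO_one_iff]
      simpa using (hi.pow 2).mul ((hi.const_sub 1).pow 2)
    -- Tail terms are controlled by `H` only through the variance constraint: `cᵢ⁴ ≤ ϑ² ≤ (2kω)² ≤
    -- (2k)² H`. The remaining factor `cᵢ²(1 - cᵢ)²` tends to 0.
    have h2 : (fun n => c n i ^ 4) =O[atTop] fun n => headSq k (c n) := by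
      refine IsBigO.of_bound ((2 * k) ^ 2) (Eventually.of_forall fun n => ?_)
      have hθ : c n i ^ 2 ≤ thetaRate k (c n) :=
        Finset.single_le_sum (f := fun i => c n i ^ 2)
          (fun _ _ => sq_nonneg _) (by simpa using not_lt.1 hik)
      have hle : c n i ^ 2 ≤ 2 * k * omegaRate k (c n) := by
        linarith [headSq_add_thetaRate_le hkM (hvar n), headSq_nonneg (k := k) (c := c n)]
      rw [Real.norm_of_nonneg (by positivity), Real.norm_of_nonneg headSq_nonneg]
      calc c n i ^ 4 = (c n i ^ 2) ^ 2 := by ring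
        _ ≤ (2 * k * omegaRate k (c n)) ^ 2 := pow_le_pow_left₀ (sq_nonneg _) hle 2
        _ = (2 * k) ^ 2 * omegaRate k (c n) ^ 2 := by ring
        _ ≤ (2 * k) ^ 2 * headSq k (c n) :=
          mul_le_mul_of_nonneg_left (omegaRate_sq_le_headSq hk hkM) (sq_nonneg _)
    refine ((h1.mul_isBigO h2).congr_left fun n => ?_).congr_right fun n => one_mul _
    ring

theorem tendsto_omegaRate (hk : 1 ≤ k) (hkM : k ≤ M)
    (hlim : ∀ i, Tendsto (fun n => c n i) atTop (𝓝 (headInd k i))) :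
    Tendsto (fun n => omegaRate k (c n)) atTop (𝓝 0) := by
  refine squeeze_zero (g := fun n => ∑ i, |headInd k i - c n i|) (fun n => omegaRate_nonneg)
    (fun n => ?_) ?_
  · obtain ⟨i, hi, h⟩ := exists_omegaRate_eq hk hkM (c n)
    rw [h]
    have := Finset.single_le_sum (f := fun i => |headInd k i - c n i|)
      (fun _ _ => abs_nonneg _) (Finset.mem_univ i)
    simpa only [headInd, if_pos hi] using this
  · simpa using tendsto_finsetSum Finset.univ fun i _ => ((hlim i).const_sub (headInd k i)).abs

/-- The criterion does not involve `m`, so `V₁` and `V₃` vanish for the same `n`; this allows bounds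
valid for every `n`. -/
theorem sum_pow_mul_eq_zero_iff {m : ℕ} (hm : Even m) (hm0 : m ≠ 0) (c : Fin M → ℝ) :
    ∑ i, c i ^ m * (1 - c i) ^ 2 = 0 ↔ ∀ i, c i = 0 ∨ c i = 1 := by
  rw [Finset.sum_eq_zero_iff_of_nonneg fun i _ => mul_nonneg (hm.pow_nonneg _) (sq_nonneg _)]
  refine ⟨fun h i => ?_, fun h i _ => ?_⟩
  · have := h i (Finset.mem_univ i)
    rcases mul_eq_zero.1 this with h' | h'
    · exact Or.inl ((pow_eq_zero_iff hm0).1 h')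
    · exact Or.inr (sub_eq_zero.1 ((pow_eq_zero_iff two_ne_zero).1 h')).symm
  · rcases h i with h' | h' <;> simp [h', hm0]

end Coefficients

end

end GammaApprox

namespace GammaApprox

/-! ### From the coefficients to the random variables -/

section Assembly

variable {Ω : Type*} [MeasurableSpace Ω] {P : Measure Ω} [IsProbabilityMeasure P] {M k : ℕ}
  {N : Fin M → Ω → ℝ}

theorem ne_zero_of_sum_sq_eq (hk : 1 ≤ k) {c : Fin M → ℝ} (hvar : ∑ i, c i ^ 2 = (k : ℝ)) :
    c ≠ 0 := by
  rintro rfl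
  have h : (0 : ℝ) = k := by simpa using hvar
  have : 0 = k := by exact_mod_cast h
  omega

theorem rateSystem_varGamma (hN : ∀ i, HasLaw (N i) (gaussianReal 0 1) P) (hind : iIndepFun N P)
    (hk : 1 ≤ k) (hkM : k ≤ M) {c : ℕ → Fin M → ℝ} (hvar : ∀ n, ∑ i, c n i ^ 2 = (k : ℝ))
    (hlim : ∀ i, Tendsto (fun n => c n i) atTop (𝓝 (headInd k i))) :
    RateSystem k (fun n => omegaRate k (c n)) (fun n => thetaRate k (c n))
      (fun n => headSq k (c n)) (fun n => varGamma N P (chiPoly (c n)) 0)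
      (fun n => varGamma N P (chiPoly (c n)) 2) where
  omega_nonneg _ := omegaRate_nonneg
  theta_nonneg _ := thetaRate_nonneg
  sq_le _ := omegaRate_sq_le_headSq hk hkM
  le_sq _ := headSq_le hkM
  add_le n := headSq_add_thetaRate_le hkM (hvar n)
  tendsto_omega := tendsto_omegaRate hk hkM hlim
  equiv_one := by
    simp_rw [fun n => varGamma_chiPoly_zero hN hind (ne_zero_of_sum_sq_eq hk (hvar n))]
    exact IsEquivalent.refl.mul (isEquivalent_sum_sq_mul hlim)
  equiv_three := by
    simp_rw [fun n => varGamma_chiPoly_two hN hind (ne_zero_of_sum_sq_eq hk (hvar n))]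
    exact IsEquivalent.refl.mul (isEquivalent_sum_pow_six_mul hk hkM hvar hlim)

theorem varGamma_chiPoly_eq_zero_iff (hN : ∀ i, HasLaw (N i) (gaussianReal 0 1) P)
    (hind : iIndepFun N P) {c : Fin M → ℝ} (hc : c ≠ 0) :
    varGamma N P (chiPoly c) 2 = 0 ↔ varGamma N P (chiPoly c) 0 = 0 := by
  rw [varGamma_chiPoly_zero hN hind hc, varGamma_chiPoly_two hN hind hc,
    mul_eq_zero_iff_left (by norm_num), mul_eq_zero_iff_left (by norm_num),
    sum_pow_mul_eq_zero_iff (by decide) (by norm_num),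
    sum_pow_mul_eq_zero_iff (by decide) (by norm_num)]

theorem integral_sub_chiTarget_sq (hN : ∀ i, HasLaw (N i) (gaussianReal 0 1) P)
    (hind : iIndepFun N P) (k : ℕ) (c : Fin M → ℝ) :
    ∫ w, (chiSum N c w - chiTarget N k w) ^ 2 ∂P = 2 * (headSq k c + thetaRate k c) := by
  rw [← sum_sub_headInd_sq, ← integral_chiSum_sq hN hind, ← chiSum_sub_chiTarget]
  rfl

theorem tendsto_eLpNorm_sub_chiTarget (hN : ∀ i, HasLaw (N i) (gaussianReal 0 1) P)
    (hind : iIndepFun N P) {c : ℕ → Fin M → ℝ}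
    (hlim : ∀ i, Tendsto (fun n => c n i) atTop (𝓝 (headInd k i))) :
    Tendsto (fun n => eLpNorm (chiSum N (c n) - chiTarget N k) 2 P) atTop (𝓝 0) := by
  have h : ∀ n, eLpNorm (chiSum N (c n) - chiTarget N k) 2 P =
      ENNReal.ofReal ((2 * ∑ i, (c n i - headInd k i) ^ 2) ^ (1 / 2 : ℝ)) := by
    intro n
    rw [chiSum_sub_chiTarget, (memLp_chiSum hN hind _).eLpNorm_eq_integral_rpow_norm
      two_ne_zero ENNReal.ofNat_ne_top, ← integral_chiSum_sq hN hind]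
    simp
  simp_rw [h]
  have h0 : Tendsto (fun n => 2 * ∑ i, (c n i - headInd k i) ^ 2) atTop (𝓝 0) := by
    simpa using (tendsto_finsetSum Finset.univ
      fun i _ => ((hlim i).sub_const (headInd k i)).pow 2).const_mul (2 : ℝ)
  have h1 := ENNReal.tendsto_ofReal (h0.rpow_const (p := (1 / 2 : ℝ)) (Or.inr (by norm_num)))
  simpa using h1

/-- For one degree of freedom the normalization forces `ϑ = 2 ω - ω ^ 2`. -/
theorem thetaRate_one_eq (hM : 1 ≤ M) {c : Fin M → ℝ} (hvar : ∑ i, c i ^ 2 = ((1 : ℕ) : ℝ)) :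
    thetaRate 1 c = 2 * omegaRate 1 c - omegaRate 1 c ^ 2 := by
  have h1 := headSq_eq_of_le_two le_rfl one_le_two hM hvar
  have h2 := headSq_le (c := c) hM
  have h3 := omegaRate_sq_le_headSq (c := c) le_rfl hM
  rw [Nat.cast_one, one_mul] at h2
  have h4 : headSq 1 c = omegaRate 1 c ^ 2 := le_antisymm h2 h3
  have h5 : ((headSq 1 c + thetaRate 1 c) / 2 - omegaRate 1 c) ^ 2 = 0 := by linarith
  have h6 := (pow_eq_zero_iff two_ne_zero).1 h5
  linarith

theorem thetaRate_eq_zero_of_eq {c : Fin M → ℝ} : thetaRate M c = 0 := by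
  refine Finset.sum_eq_zero fun i hi => ?_
  exact absurd (Finset.mem_filter.1 hi).2 (not_le.2 i.isLt)

end Assembly

end GammaApprox

theorem mainTheorem10
    {Ω : Type*} [MeasurableSpace Ω] (P : Measure Ω) [IsProbabilityMeasure P]
    {Ω' : Type*} [MeasurableSpace Ω'] (P' : Measure Ω') [IsProbabilityMeasure P']
    (ν : ℝ) (hν : 0 < ν) (M : ℕ) (hM : 2 ≤ M)
    (N : Fin M → Ω → ℝ) (hN : ∀ i, HasLaw (N i) (gaussianReal 0 1) P) (hind : iIndepFun N P)
    (c : ℕ → Fin M → ℝ) (hord : ∀ n, Antitone fun i => |c n i|)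
    (hvar : ∀ n, ∑ i, c n i ^ 2 = ν)
    (G : Ω' → ℝ) (hG : HasLaw G (centeredGamma ν) P')
    (hconv : TendstoInDistribution (fun n => chiSum N (c n)) atTop G (fun _ => P) P') :
    ∃ k : ℕ, 1 ≤ k ∧ k ≤ M ∧ ν = k ∧
      -- the target is a centered chi-square with `k` degrees of freedom
      HasLaw (chiTarget N k) (centeredGamma ν) P ∧
      -- convergence in `L²`, and its rate
      (∀ n, MemLp (chiSum N (c n) - chiTarget N k) 2 P) ∧
      Tendsto (fun n => eLpNorm (chiSum N (c n) - chiTarget N k) 2 P) atTop (𝓝 0) ∧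
      (∃ C₁ C₂ : ℝ, 0 < C₁ ∧ C₁ < C₂ ∧ ∀ n,
        C₁ * max (omegaRate k (c n) ^ 2) (thetaRate k (c n)) ≤
          ∫ w, (chiSum N (c n) w - chiTarget N k w) ^ 2 ∂P ∧
        ∫ w, (chiSum N (c n) w - chiTarget N k w) ^ 2 ∂P ≤
          C₂ * max (omegaRate k (c n) ^ 2) (thetaRate k (c n))) ∧
      -- (a), orders of magnitude
      ((fun n => varGamma N P (chiPoly (c n)) 2) =Θ[atTop]
          (fun n => varGamma N P (chiPoly (c n)) 0 ^ 2) ↔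
        (fun n => thetaRate k (c n)) =Θ[atTop] (fun n => omegaRate k (c n))) ∧
      (k = 1 → (fun n => thetaRate k (c n)) =Θ[atTop] (fun n => omegaRate k (c n))) ∧
      -- (b), orders of magnitude
      ((fun n => varGamma N P (chiPoly (c n)) 2) =Θ[atTop]
          (fun n => varGamma N P (chiPoly (c n)) 0) ↔
        (fun n => thetaRate k (c n)) =O[atTop] (fun n => omegaRate k (c n) ^ 2)) ∧
      ((∃ l : ENNReal, Tendsto (fun n => ENNReal.ofReal (thetaRate k (c n)) /
            ENNReal.ofReal (omegaRate k (c n) ^ 2)) atTop (𝓝 l)) →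
        ((fun n => varGamma N P (chiPoly (c n)) 2) =Θ[atTop]
            (fun n => varGamma N P (chiPoly (c n)) 0) ↔
          k = M ∨
          (fun n => thetaRate k (c n)) =Θ[atTop] (fun n => omegaRate k (c n) ^ 2) ∨
          (fun n => thetaRate k (c n)) =o[atTop] (fun n => omegaRate k (c n) ^ 2))) ∧
      -- two-sided estimates valid for every `n`
      ((k = 1 ∨ (fun n => thetaRate k (c n)) =Θ[atTop] (fun n => omegaRate k (c n))) →
        ∃ C₁ C₂ : ℝ, 0 < C₁ ∧ C₁ < C₂ ∧ ∀ n,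
          C₁ * varGamma N P (chiPoly (c n)) 0 ^ 2 ≤ varGamma N P (chiPoly (c n)) 2 ∧
          varGamma N P (chiPoly (c n)) 2 ≤ C₂ * varGamma N P (chiPoly (c n)) 0 ^ 2) ∧
      ((k = M ∨
          (fun n => thetaRate k (c n)) =Θ[atTop] (fun n => omegaRate k (c n) ^ 2) ∨
          (fun n => thetaRate k (c n)) =o[atTop] (fun n => omegaRate k (c n) ^ 2)) →
        ∃ C₁ C₂ : ℝ, 0 < C₁ ∧ C₁ < C₂ ∧ ∀ n,
          C₁ * varGamma N P (chiPoly (c n)) 0 ≤ varGamma N P (chiPoly (c n)) 2 ∧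
          varGamma N P (chiPoly (c n)) 2 ≤ C₂ * varGamma N P (chiPoly (c n)) 0) ∧
      -- (a) and (b) with `≈_C` meaning convergence of the ratio to a positive constant
      (k = 1 → (∀ᶠ n in atTop, omegaRate k (c n) ≠ 0) →
        ApproxC (fun n => thetaRate k (c n)) (fun n => omegaRate k (c n))) ∧
      ((∀ᶠ n in atTop, omegaRate k (c n) ≠ 0) →
        (k ≤ 2 ∨
          ∃ s : ℝ, Tendsto (fun n => headSq k (c n) / omegaRate k (c n) ^ 2) atTop (𝓝 s)) →
        (ApproxC (fun n => varGamma N P (chiPoly (c n)) 2)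
            (fun n => varGamma N P (chiPoly (c n)) 0 ^ 2) ↔
          ApproxC (fun n => thetaRate k (c n)) (fun n => omegaRate k (c n))) ∧
        (ApproxC (fun n => varGamma N P (chiPoly (c n)) 2)
            (fun n => varGamma N P (chiPoly (c n)) 0) ↔
          k = M ∨
          ApproxC (fun n => thetaRate k (c n)) (fun n => omegaRate k (c n) ^ 2) ∨
          (fun n => thetaRate k (c n)) =o[atTop] (fun n => omegaRate k (c n) ^ 2))) := by
  obtain ⟨k, hk, hkM, rfl, hlaw, hlim⟩ := exists_tendsto_headInd hν hN hind hord hvar hG hconv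
  have hR := rateSystem_varGamma hN hind hk hkM hvar hlim
  have hne : ∀ n, c n ≠ 0 := fun n => ne_zero_of_sum_sq_eq hk (hvar n)
  have hone : k = 1 → (fun n => thetaRate k (c n)) =Θ[atTop] (fun n => omegaRate k (c n)) := by
    rintro rfl
    simp_rw [fun n => thetaRate_one_eq hkM (hvar n)]
    have h1 : (fun n => 2 * omegaRate 1 (c n)) =Θ[atTop] (fun n => omegaRate 1 (c n)) :=
      (isTheta_const_mul_left two_ne_zero).2 isTheta_rfl
    have h2 := (hR.head_isTheta.2.trans_isLittleO hR.head_isLittleO).neg_left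
    exact h1.add_isLittleO h2
  have hsmall : (k = M ∨
      (fun n => thetaRate k (c n)) =Θ[atTop] (fun n => omegaRate k (c n) ^ 2) ∨
      (fun n => thetaRate k (c n)) =o[atTop] (fun n => omegaRate k (c n) ^ 2)) →
      (fun n => thetaRate k (c n)) =O[atTop] (fun n => omegaRate k (c n) ^ 2) := by
    rintro (rfl | h | h)
    · simp_rw [thetaRate_eq_zero_of_eq]
      exact isBigO_zero _ _
    · exact h.1
    · exact h.isBigO
  -- The squared distance is `2(H + ϑ)` with `ω² ≤ H ≤ kω²`, which gives the constants `1` and `2(k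
  -- + 1)`.
  refine ⟨k, hk, hkM, rfl, hlaw, fun n => ?_, tendsto_eLpNorm_sub_chiTarget hN hind hlim,
    ⟨1, 2 * (k + 1), one_pos, ?_, fun n => ?_⟩, hR.three_isTheta_sq_iff, hone,
    hR.three_isTheta_iff, ?_, fun h => ?_, fun h => ?_, ?_, fun hω hcase => ?_⟩
  · rw [chiSum_sub_chiTarget]
    exact memLp_chiSum hN hind _
  · linarith
  · rw [integral_sub_chiTarget_sq hN hind]
    have h1 := hR.sq_le n
    have h2 := hR.le_sq n
    have h3 := hR.theta_nonneg n
    have h4 := hR.head_nonneg n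
    constructor
    · rw [one_mul]
      exact max_le (by linarith) (by linarith)
    · have h5 := le_max_left (omegaRate k (c n) ^ 2) (thetaRate k (c n))
      have h6 := le_max_right (omegaRate k (c n) ^ 2) (thetaRate k (c n))
      have h7 := mul_le_mul_of_nonneg_left h5 hν.le
      linarith
  · rintro ⟨l, hl⟩
    rw [hR.three_isTheta_iff]
    exact ⟨fun h => Or.inr (hR.isTheta_or_isLittleO_of_isBigO hl h), hsmall⟩
  · have hθ : (fun n => thetaRate k (c n)) =Θ[atTop] (fun n => omegaRate k (c n)) :=
      h.elim hone id
    refine exists_bounds_of_isTheta (fun n => variance_nonneg _ _) (fun n => sq_nonneg _) (fun n => ?_)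
      (hR.three_isTheta_sq_iff.2 hθ)
    rw [varGamma_chiPoly_eq_zero_iff hN hind (hne n), pow_eq_zero_iff two_ne_zero]
  · exact exists_bounds_of_isTheta (fun n => variance_nonneg _ _) (fun n => variance_nonneg _ _)
      (fun n => varGamma_chiPoly_eq_zero_iff hN hind (hne n)) (hR.three_isTheta_iff.2 (hsmall h))
  · rintro rfl hω
    -- For `k = 1` the ratio `ϑ / ω` equals `2 - ω`.
    refine ⟨2, two_pos, ?_⟩
    have h1 := hR.tendsto_omega.const_sub 2
    rw [sub_zero] at h1
    refine h1.congr' ?_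
    filter_upwards [hω] with n hn
    rw [thetaRate_one_eq hkM (hvar n)]
    field_simp
  · have hquad : k ≤ 2 → ∀ n, headSq k (c n) = omegaRate k (c n) ^ 2 +
        ((headSq k (c n) + thetaRate k (c n)) / 2 - omegaRate k (c n)) ^ 2 := fun h2 n =>
      headSq_eq_of_le_two hk h2 hkM (hvar n)
    refine ⟨hR.approxC_three_sq_iff_theta hω
      (hcase.imp_left fun h2 => ⟨by exact_mod_cast h2, hquad h2⟩), ?_⟩
    rw [hR.approxC_three_iff_theta hω (hcase.imp_left hquad)]
    refine ⟨Or.inr, ?_⟩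
    rintro (rfl | h)
    · right
      simp_rw [thetaRate_eq_zero_of_eq]
      exact isLittleO_zero _ _
    · exact h
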